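/- A rectangle is a Cartesian product $\mathcal{R}=(a,b)\times(c,d)$ of two bounded nonempty open intervals, with perimeter $L=L(\mathcal{R})=2\big((b-a)+(d-c)\big)$; it is a square if $b-a=d-c$. For $\beta\in\mathbb{R}$ and $k\ge 1$, let $\lambda_k(\mathcal{R};\beta)$ be the $k$-th eigenvalue (counted with multiplicity) of the Robin Laplacian $$-\Delta u=\lambda u \ \text{ in } \mathcal{R},\qquad \frac{\partial u}{\partial \nu}+\beta u=0\ \text{ on }\partial\mathcal{R},$$ that is, $$\lambda_k(\mathcal{R};\beta)=\min_{U_k}\ \max_{u\in U_k\setminus\{0\}}\ \frac{\int_{\mathcal{R}}|\nabla u|^2\,dx+\beta\int_{\partial\mathcal{R}}u^2\,dS}{\int_{\mathcal{R}}u^2\,dx},$$ where $U_k$ ranges over the $k$-dimensional subspaces of $H^1(\mathcal{R})$. Fix $\alpha>0$. Then $\lambda_1(\mathcal{R};\alpha/L)>0$ for every rectangle $\mathcal{R}$, and the length-scaled Robin spectral ratio $$\frac{\lambda_2(\mathcal{R};\alpha/L(\mathcal{R}))}{|\lambda_1(\mathcal{R};\alpha/L(\mathcal{R}))|}$$ is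 maximal, among all rectangles $\mathcal{R}$, for the square and only the square: a rectangle attains the maximum if and only if it is a square. -/

import Mathlib

open MeasureTheory Set

noncomputable section

/-- A rectangle in the plane: the product of two bounded nonempty open intervals
`(a, b)` and `(c, d)`. -/
structure Rectangle where
  a : ℝ
  b : ℝ
  c : ℝ
  d : ℝ
  hab : a < b
  hcd : c < d

/-- Real `L²` on a set `s`, with respect to Lebesgue measure. -/
abbrev L2On {X : Type} [MeasureSpace X] (s : Set X) : Type :=
  Lp ℝ 2 ((volume : Measure X).restrict s)

namespace Rectangle

/-- The underlying open set. -/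
def domain (R : Rectangle) : Set (ℝ × ℝ) := Ioo R.a R.b ×ˢ Ioo R.c R.d

/-- The perimeter `L`. -/
def perimeter (R : Rectangle) : ℝ := 2 * ((R.b - R.a) + (R.d - R.c))

/-- The rectangle is a square. -/
def IsSq (R : Rectangle) : Prop := R.b - R.a = R.d - R.c

/-- Candidate tuples `(u, (∂ₓu, ∂ᵧu), (left trace, right trace), (bottom trace, top trace))`:
a function on the rectangle, its gradient, and its boundary values on the two vertical and on
the two horizontal sides, all of class `L²`. -/
abbrev Tuple (R : Rectangle) : Type :=
  L2On R.domain × (L2On R.domain × L2On R.domain) ×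
    (L2On (Ioo R.c R.d) × L2On (Ioo R.c R.d)) × (L2On (Ioo R.a R.b) × L2On (Ioo R.a R.b))

section Components

variable {R : Rectangle} (w : R.Tuple)

/-- The function itself. -/
def val : L2On R.domain := w.1
/-- The `x`-derivative. -/
def dx : L2On R.domain := w.2.1.1
/-- The `y`-derivative. -/
def dy : L2On R.domain := w.2.1.2
/-- Boundary values on the side `x = a`. -/
def left : L2On (Ioo R.c R.d) := w.2.2.1.1
/-- Boundary values on the side `x = b`. -/
def right : L2On (Ioo R.c R.d) := w.2.2.1.2
/-- Boundary values on the side `y = c`. -/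
def bottom : L2On (Ioo R.a R.b) := w.2.2.2.1
/-- Boundary values on the side `y = d`. -/
def top : L2On (Ioo R.a R.b) := w.2.2.2.2

end Components

/-- The Sobolev space `H¹(R)`, each function being listed together with its weak gradient and
its boundary trace. Membership is the Gauss-Green formula
`∫_R u ∂ᵢφ + ∫_R (∂ᵢu) φ = ∫_{∂R} (trace u) φ νᵢ` for `i = 1, 2` and all `φ` of class `C¹` up to
the boundary. Taking `φ` with compact support in `R`, it says that `dx w`, `dy w` are the weak
partial derivatives of `val w`; the general `φ` then pins down the traces. So a member is
determined by `val w`, and by the trace theorem every function in `H¹(R)` occurs. -/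
def H1 (R : Rectangle) : Set R.Tuple :=
  {w | ∀ φ : ℝ × ℝ → ℝ, ContDiff ℝ 1 φ →
    ((∫ z in R.domain, val w z * fderiv ℝ φ z (1, 0)) + (∫ z in R.domain, dx w z * φ z)
      = (∫ y in Ioo R.c R.d, right w y * φ (R.b, y))
        - ∫ y in Ioo R.c R.d, left w y * φ (R.a, y)) ∧
    ((∫ z in R.domain, val w z * fderiv ℝ φ z (0, 1)) + (∫ z in R.domain, dy w z * φ z)
      = (∫ x in Ioo R.a R.b, top w x * φ (x, R.d))
        - ∫ x in Ioo R.a R.b, bottom w x * φ (x, R.c))}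

/-- `∫_R |∇u|² + β ∫_{∂R} u² dS`. -/
def robinForm (R : Rectangle) (β : ℝ) (w : R.Tuple) : ℝ :=
  (∫ z in R.domain, ((dx w z) ^ 2 + (dy w z) ^ 2))
    + β * ((∫ y in Ioo R.c R.d, (left w y) ^ 2) + (∫ y in Ioo R.c R.d, (right w y) ^ 2)
      + (∫ x in Ioo R.a R.b, (bottom w x) ^ 2) + (∫ x in Ioo R.a R.b, (top w x) ^ 2))

/-- The Rayleigh quotient of the Robin Laplacian with parameter `β`. -/
def rayleigh (R : Rectangle) (β : ℝ) (w : R.Tuple) : ℝ :=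
  R.robinForm β w / ∫ z in R.domain, (val w z) ^ 2

/-- The `k`-th Robin eigenvalue (`k = 1, 2, …`, counted with multiplicity) of the Laplacian on
`R` with Robin parameter `β`: the minimum, over the `k`-dimensional subspaces `U` of `H¹(R)`, of
the maximum of the Rayleigh quotient over the nonzero elements of `U`. -/
def robinEigenvalue (R : Rectangle) (k : ℕ) (β : ℝ) : ℝ :=
  sInf {M : ℝ | ∃ U : Submodule ℝ R.Tuple, (U : Set R.Tuple) ⊆ R.H1 ∧ Module.finrank ℝ U = k ∧
    IsGreatest {r : ℝ | ∃ w ∈ U, w ≠ 0 ∧ r = R.rayleigh β w} M}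

/-- The length-scaled Robin spectral ratio `λ₂(R; α/L) / |λ₁(R; α/L)|`. -/
def spectralRatio (R : Rectangle) (α : ℝ) : ℝ :=
  R.robinEigenvalue 2 (α / R.perimeter) / |R.robinEigenvalue 1 (α / R.perimeter)|

end Rectangle

end

/-! Separation of variables reduces everything to one dimension. On an interval of half-length `t`
with parameter `β > 0`, put `s = β t`. The first two frequencies are `x / t` and `y / t`, where `x
tan x = s` with `x` in `(0, π/2)` (even mode) and `-y cot y = s` with `y` in `(π/2, π)` (odd mode).
In units of `β²`, let `F(s) = (x/s)²` be the first eigenvalue and `G(s) = (y/s)² - (x/s)²` the gap.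
For a rectangle with scaled half-sides `s, t`, the first eigenvalue is `F(s) + F(t)`, and the second
adds the smaller of the two gaps, so the ratio is `1 + min (G s) (G t) / (F s + F t)`. The length
scaling `β = α/L` fixes `s + t = α/4`. Since `F` is convex (`convexOn_scaledFirst`), the denominator
is smallest at `s = t = α/8`. Since `G` is strictly decreasing (`strictAntiOn_scaledGap`), the
longer side makes the numerator smaller than `G(α/8)` unless `s = t`.

The eigenvalue formulas come from min-max. Upper bounds use products of interval modes, which
satisfy the weak eigenvalue equation against all of `H1` (`robinInner_prodTuple`). Lower bounds must
hold for every member of `H1`, which is known only through Gauss-Green. Instead of approximating `w`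
by smooth functions, `dual_lower_bound` argues by duality: smooth solutions `φ` of a one-variable
Robin problem are tested against `w`, so that the gap inequality `robin_gap_bound` is needed only
for `φ`, slice by slice. This bounds each directional half of the form in terms of the projection
onto functions (first mode) ⊗ (anything). When `w` is orthogonal to the product of the first modes,
the squared norms of its two projections sum to at most `‖w‖²` (`norm_sq_proj_add_le`), and adding
the halves gives the second eigenvalue. -/

noncomputable section

open scoped Real InnerProductSpace
open MeasureTheory Set Filter Topology

/-! ### The one-dimensional Robin problem: Riccati comparison and gap inequality -/

/-- Riccati form of the Jacobi inequality. -/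
theorem riccati_le_dirichlet {t K : ℝ} (ht : 0 ≤ t) {f f' g : ℝ → ℝ}
    (hf : ∀ x, HasDerivAt f (f' x) x) (hf' : Continuous f')
    (hg : ∀ x ∈ Icc 0 t, HasDerivAt g (-K - g x ^ 2) x) :
    K * (∫ x in (0 : ℝ)..t, f x ^ 2) + (g t * f t ^ 2 - g 0 * f 0 ^ 2)
      ≤ ∫ x in (0 : ℝ)..t, f' x ^ 2 := by
  have hfc : Continuous f := continuous_iff_continuousAt.2 fun x => (hf x).continuousAt
  have hgc : ContinuousOn g (uIcc 0 t) := by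
    rw [uIcc_of_le ht]; exact fun x hx => (hg x hx).continuousAt.continuousWithinAt
  have hVc : ContinuousOn (fun x => (-K - g x ^ 2) * f x ^ 2 + g x * (2 * f x * f' x))
      (uIcc 0 t) := by fun_prop
  have hV : ∀ x ∈ uIcc 0 t, HasDerivAt (fun x => g x * f x ^ 2)
      ((-K - g x ^ 2) * f x ^ 2 + g x * (2 * f x * f' x)) x := by
    intro x hx
    rw [uIcc_of_le ht] at hx
    refine ((hg x hx).mul ((hf x).pow 2)).congr_deriv ?_
    simp only [Pi.pow_apply]; push_cast; ring
  have hI := intervalIntegral.integral_eq_sub_of_hasDerivAt hV hVc.intervalIntegrable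
  rw [← hI, ← intervalIntegral.integral_const_mul, ← intervalIntegral.integral_add]
  · refine intervalIntegral.integral_mono_on ht ?_ ?_ ?_
    · exact ContinuousOn.intervalIntegrable (by fun_prop)
    · exact (hf'.pow 2).intervalIntegrable _ _
    · intro x _
      nlinarith [sq_nonneg (f' x - g x * f x)]
  · exact (continuous_const.mul (hfc.pow 2)).intervalIntegrable _ _
  · exact hVc.intervalIntegrable

/-- Lower bound for the Dirichlet–Robin problem on `[0, t]`. -/
theorem dirichlet_robin_bound {t κ β : ℝ} (ht : 0 < t) (hκ : π / 2 < κ * t) (hκ' : κ * t < π)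
    (hβ : κ * Real.cos (κ * t) = -(β * Real.sin (κ * t))) {f f' : ℝ → ℝ}
    (hf : ∀ x, HasDerivAt f (f' x) x) (hf' : Continuous f') (h0 : f 0 = 0) :
    κ ^ 2 * (∫ x in (0 : ℝ)..t, f x ^ 2) ≤ (∫ x in (0 : ℝ)..t, f' x ^ 2) + β * f t ^ 2 := by
  have hpi := Real.pi_pos
  have hκ0 : 0 < κ := by
    by_contra h
    nlinarith [mul_nonneg (sub_nonneg.2 (not_lt.1 h)) ht.le]
  have hsin : 0 < Real.sin (κ * t) := Real.sin_pos_of_pos_of_lt_pi (by linarith) hκ'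
  -- The natural Riccati solution `κ cot(κ x)` blows up at `x = 0`. Lowering the frequency to `η κ`
  -- and adding the phase `(1 - η) κ t` keeps the angle in `(0, π)` on all of `[0, t]` and still
  -- equal to `κ t` at `x = t`; then `η → 1`.
  have key : ∀ η : ℝ, η ∈ Ioo (0 : ℝ) 1 →
      (η * κ) ^ 2 * (∫ x in (0 : ℝ)..t, f x ^ 2) ≤
        (∫ x in (0 : ℝ)..t, f' x ^ 2) + η * (β * f t ^ 2) := by
    rintro η ⟨hη0, hη1⟩
    have hg : ∀ x ∈ Icc 0 t, HasDerivAt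
        (fun x => η * κ * (Real.cos (η * κ * x + (1 - η) * (κ * t)) /
          Real.sin (η * κ * x + (1 - η) * (κ * t))))
        (-(η * κ) ^ 2 - (η * κ * (Real.cos (η * κ * x + (1 - η) * (κ * t)) /
          Real.sin (η * κ * x + (1 - η) * (κ * t)))) ^ 2) x := by
      rintro x ⟨hx0, hxt⟩
      have hηκ : 0 < η * κ := mul_pos hη0 hκ0
      have hs : 0 < Real.sin (η * κ * x + (1 - η) * (κ * t)) := by
        apply Real.sin_pos_of_pos_of_lt_pi
        · have := mul_nonneg hηκ.le hx0
          have : 0 < (1 - η) * (κ * t) := mul_pos (by linarith) (mul_pos hκ0 ht)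
          linarith
        · have := mul_le_mul_of_nonneg_left hxt hηκ.le
          nlinarith
      have hl : HasDerivAt (fun x => η * κ * x + (1 - η) * (κ * t)) (η * κ) x := by
        simpa using ((hasDerivAt_id x).const_mul (η * κ)).add_const ((1 - η) * (κ * t))
      refine ((hl.cos.div hl.sin hs.ne').const_mul (η * κ)).congr_deriv ?_
      generalize Real.sin (η * κ * x + (1 - η) * (κ * t)) = S at *
      generalize Real.cos (η * κ * x + (1 - η) * (κ * t)) = C at *
      field_simp
    have := riccati_le_dirichlet (K := (η * κ) ^ 2) ht.le hf hf' hg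
    rw [h0] at this
    have e : η * κ * t + (1 - η) * (κ * t) = κ * t := by ring
    rw [e] at this
    have e2 : η * κ * (Real.cos (κ * t) / Real.sin (κ * t)) = - (η * β) := by
      field_simp; linarith
    rw [e2] at this
    nlinarith
  have hl : Filter.Tendsto (fun η : ℝ => (η * κ) ^ 2 * (∫ x in (0 : ℝ)..t, f x ^ 2))
      (nhdsWithin 1 (Iio 1)) (nhds (κ ^ 2 * (∫ x in (0 : ℝ)..t, f x ^ 2))) := by
    have : Continuous (fun η : ℝ => (η * κ) ^ 2 * (∫ x in (0 : ℝ)..t, f x ^ 2)) := by fun_prop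
    simpa using (this.tendsto 1).mono_left nhdsWithin_le_nhds
  have hr : Filter.Tendsto (fun η : ℝ => (∫ x in (0 : ℝ)..t, f' x ^ 2) + η * (β * f t ^ 2))
      (nhdsWithin 1 (Iio 1)) (nhds ((∫ x in (0 : ℝ)..t, f' x ^ 2) + β * f t ^ 2)) := by
    have : Continuous (fun η : ℝ => (∫ x in (0 : ℝ)..t, f' x ^ 2) + η * (β * f t ^ 2)) := by
      fun_prop
    simpa using (this.tendsto 1).mono_left nhdsWithin_le_nhds
  exact le_of_tendsto_of_tendsto hl hr
    (Filter.eventually_of_mem (Ioo_mem_nhdsLT one_pos) key)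

/-- `k ^ 2` and `κ ^ 2` are the first two Robin eigenvalues of an interval of length `2 * t`. -/
structure RobinFreq (β t k κ : ℝ) : Prop where
  t_pos : 0 < t
  k_pos : 0 < k
  k_lt : k * t < π / 2
  k_eq : k * Real.sin (k * t) = β * Real.cos (k * t)
  lt_κ : π / 2 < κ * t
  κ_lt : κ * t < π
  κ_eq : κ * Real.cos (κ * t) = -(β * Real.sin (κ * t))

theorem RobinFreq.lt {β t k κ : ℝ} (h : RobinFreq β t k κ) : k < κ :=
  lt_of_mul_lt_mul_right (h.k_lt.trans h.lt_κ) h.t_pos.le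

theorem RobinFreq.sq_lt {β t k κ : ℝ} (h : RobinFreq β t k κ) : k ^ 2 < κ ^ 2 := by
  have := h.lt; have := h.k_pos; nlinarith

/-- The cosine of frequency `k` centred on `[a, b]`. -/
def cosMode (a b k : ℝ) (x : ℝ) : ℝ := Real.cos (k * (x - (a + b) / 2))

/-- The sine of frequency `k` centred on `[a, b]`. -/
def sinMode (a b k : ℝ) (x : ℝ) : ℝ := Real.sin (k * (x - (a + b) / 2))

theorem hasDerivAt_cosMode (a b k x : ℝ) :
    HasDerivAt (cosMode a b k) (-k * sinMode a b k x) x := by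
  have hl : HasDerivAt (fun x => k * (x - (a + b) / 2)) k x := by
    simpa using ((hasDerivAt_id x).sub_const ((a + b) / 2)).const_mul k
  refine hl.cos.congr_deriv ?_
  simp only [sinMode]; ring

theorem hasDerivAt_sinMode (a b k x : ℝ) :
    HasDerivAt (sinMode a b k) (k * cosMode a b k x) x := by
  have hl : HasDerivAt (fun x => k * (x - (a + b) / 2)) k x := by
    simpa using ((hasDerivAt_id x).sub_const ((a + b) / 2)).const_mul k
  refine hl.sin.congr_deriv ?_
  simp only [cosMode]; ring

theorem contDiff_cosMode (a b k : ℝ) : ContDiff ℝ 2 (cosMode a b k) := by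
  unfold cosMode; fun_prop

theorem contDiff_sinMode (a b k : ℝ) : ContDiff ℝ 2 (sinMode a b k) := by
  unfold sinMode; fun_prop

@[fun_prop]
theorem continuous_cosMode (a b k : ℝ) : Continuous (cosMode a b k) :=
  (contDiff_cosMode a b k).continuous

@[fun_prop]
theorem continuous_sinMode (a b k : ℝ) : Continuous (sinMode a b k) :=
  (contDiff_sinMode a b k).continuous

theorem integral_cosMode_sq_pos {a b β k κ : ℝ} (h : RobinFreq β ((b - a) / 2) k κ) :
    0 < ∫ x in a..b, cosMode a b k x ^ 2 := by
  have hab : a < b := by linarith [h.t_pos]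
  refine intervalIntegral.intervalIntegral_pos_of_pos_on
    (((continuous_cosMode a b k).pow 2).intervalIntegrable _ _) ?_ hab
  rintro x ⟨hxa, hxb⟩
  have : 0 < cosMode a b k x := by
    apply Real.cos_pos_of_mem_Ioo
    have h1 : k * (x - (a + b) / 2) < k * ((b - a) / 2) :=
      mul_lt_mul_of_pos_left (by linarith) h.k_pos
    have h2 : k * (-((b - a) / 2)) < k * (x - (a + b) / 2) :=
      mul_lt_mul_of_pos_left (by linarith) h.k_pos
    have := h.k_lt
    constructor <;> linarith
  positivity

/-- A `C¹` function vanishing at the midpoint satisfies the second eigenvalue bound. -/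
theorem robin_bound_of_midpoint_zero {a b β k κ : ℝ} (h : RobinFreq β ((b - a) / 2) k κ)
    {f f' : ℝ → ℝ} (hf : ∀ x, HasDerivAt f (f' x) x) (hf' : Continuous f')
    (h0 : f ((a + b) / 2) = 0) :
    κ ^ 2 * (∫ x in a..b, f x ^ 2) ≤
      (∫ x in a..b, f' x ^ 2) + β * (f a ^ 2 + f b ^ 2) := by
  set m := (a + b) / 2 with hm
  set t := (b - a) / 2 with ht
  have hfc : Continuous f := continuous_iff_continuousAt.2 fun x => (hf x).continuousAt
  have hA : ∀ x, HasDerivAt (fun x => f (x + m)) (f' (x + m)) x := fun x => by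
    simpa using (hf (x + m)).comp_add_const x m
  have hB : ∀ x, HasDerivAt (fun x => f (m - x)) (-f' (m - x)) x := fun x => by
    simpa using (hf (m - x)).comp_const_sub m x
  have e1 := dirichlet_robin_bound h.t_pos h.lt_κ h.κ_lt h.κ_eq hA (by fun_prop) (by simpa using h0)
  have e2 := dirichlet_robin_bound h.t_pos h.lt_κ h.κ_lt h.κ_eq hB (by fun_prop) (by simpa using h0)
  simp only [neg_sq] at e2
  rw [intervalIntegral.integral_comp_add_right (fun x => f x ^ 2),
    intervalIntegral.integral_comp_add_right (fun x => f' x ^ 2)] at e1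
  rw [intervalIntegral.integral_comp_sub_left (fun x => f x ^ 2),
    intervalIntegral.integral_comp_sub_left (fun x => f' x ^ 2)] at e2
  have c1 : t + m = b := by rw [hm, ht]; ring
  have c2 : m - t = a := by rw [hm, ht]; ring
  rw [c1, zero_add] at e1
  rw [c2, sub_zero] at e2
  rw [← intervalIntegral.integral_add_adjacent_intervals (b := m) (f := fun x => f x ^ 2)
    ((hfc.pow 2).intervalIntegrable a m) ((hfc.pow 2).intervalIntegrable m b),
    ← intervalIntegral.integral_add_adjacent_intervals (b := m) (f := fun x => f' x ^ 2)
    ((hf'.pow 2).intervalIntegrable a m) ((hf'.pow 2).intervalIntegrable m b)]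
  linarith

theorem cosMode_left (a b k : ℝ) : cosMode a b k a = Real.cos (k * ((b - a) / 2)) := by
  rw [cosMode, ← Real.cos_neg]; congr 1; ring
theorem cosMode_right (a b k : ℝ) : cosMode a b k b = Real.cos (k * ((b - a) / 2)) := by
  rw [cosMode]; congr 1; ring
theorem sinMode_left (a b k : ℝ) : sinMode a b k a = -Real.sin (k * ((b - a) / 2)) := by
  rw [sinMode, ← Real.sin_neg]; congr 1; ring
theorem sinMode_right (a b k : ℝ) : sinMode a b k b = Real.sin (k * ((b - a) / 2)) := by
  rw [sinMode]; congr 1; ring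

/-- Integration by parts; the Robin condition `h.k_eq` absorbs the boundary terms. It evaluates the
cross term and the square of the mode in `robin_gap_bound`. -/
theorem cosMode_weak {a b β k κ : ℝ} (h : RobinFreq β ((b - a) / 2) k κ)
    {f f' : ℝ → ℝ} (hf : ∀ x, HasDerivAt f (f' x) x) (hf' : Continuous f') :
    (∫ x in a..b, f' x * (-k * sinMode a b k x)) +
        β * (f a * cosMode a b k a + f b * cosMode a b k b) =
      k ^ 2 * ∫ x in a..b, f x * cosMode a b k x := by
  have hfc : Continuous f := continuous_iff_continuousAt.2 fun x => (hf x).continuousAt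
  have hd : ∀ x ∈ uIcc a b, HasDerivAt (fun x => f x * (-k * sinMode a b k x))
      (f' x * (-k * sinMode a b k x) - k ^ 2 * (f x * cosMode a b k x)) x := fun x _ => by
    refine ((hf x).mul ((hasDerivAt_sinMode a b k x).const_mul (-k))).congr_deriv ?_
    ring
  have hI := intervalIntegral.integral_eq_sub_of_hasDerivAt hd
    (Continuous.intervalIntegrable (by fun_prop) _ _)
  rw [intervalIntegral.integral_sub (Continuous.intervalIntegrable (by fun_prop) _ _)
    (Continuous.intervalIntegrable (by fun_prop) _ _), intervalIntegral.integral_const_mul] at hI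
  rw [cosMode_left, cosMode_right]
  rw [sinMode_left, sinMode_right] at hI
  linear_combination hI + (-f a - f b) * h.k_eq

/-- Gap inequality on an interval: `q ≥ κ² - (κ² - k²) P`, with `P` the projection on the first
mode. -/
theorem robin_gap_bound {a b β k κ : ℝ} (h : RobinFreq β ((b - a) / 2) k κ)
    {f f' : ℝ → ℝ} (hf : ∀ x, HasDerivAt f (f' x) x) (hf' : Continuous f') :
    κ ^ 2 * (∫ x in a..b, f x ^ 2) -
        (κ ^ 2 - k ^ 2) * ((∫ x in a..b, cosMode a b k x ^ 2)⁻¹ *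
          (∫ x in a..b, f x * cosMode a b k x) ^ 2) ≤
      (∫ x in a..b, f' x ^ 2) + β * (f a ^ 2 + f b ^ 2) := by
  have hfc : Continuous f := continuous_iff_continuousAt.2 fun x => (hf x).continuousAt
  -- The mode equals `1` at the midpoint, so `f - v * cosMode` vanishes there and obeys the bound
  -- with `κ²`.
  set v := f ((a + b) / 2) with hv
  set N := ∫ x in a..b, cosMode a b k x ^ 2 with hN
  have hNpos : 0 < N := integral_cosMode_sq_pos h
  set J := ∫ x in a..b, f x * cosMode a b k x with hJ
  have hg : ∀ x, HasDerivAt (fun x => f x - v * cosMode a b k x)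
      (f' x - v * (-k * sinMode a b k x)) x := fun x =>
    (hf x).sub ((hasDerivAt_cosMode a b k x).const_mul v)
  have key := robin_bound_of_midpoint_zero h hg (by fun_prop) (by simp [cosMode, hv])
  have hw := cosMode_weak h hf hf'
  have hw2 := cosMode_weak h (hasDerivAt_cosMode a b k) (by fun_prop)
  have i1 : ∫ x in a..b, (f x - v * cosMode a b k x) ^ 2 =
      (∫ x in a..b, f x ^ 2) - 2 * v * J + v ^ 2 * N := by
    rw [hJ, hN, ← intervalIntegral.integral_const_mul, ← intervalIntegral.integral_const_mul,
      ← intervalIntegral.integral_sub, ← intervalIntegral.integral_add]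
    · exact intervalIntegral.integral_congr fun x _ => by ring
    all_goals exact Continuous.intervalIntegrable (by fun_prop) _ _
  have i2 : ∫ x in a..b, (f' x - v * (-k * sinMode a b k x)) ^ 2 =
      (∫ x in a..b, f' x ^ 2) - 2 * v * (∫ x in a..b, f' x * (-k * sinMode a b k x))
        + v ^ 2 * ∫ x in a..b, -k * sinMode a b k x * (-k * sinMode a b k x) := by
    rw [← intervalIntegral.integral_const_mul, ← intervalIntegral.integral_const_mul,
      ← intervalIntegral.integral_sub, ← intervalIntegral.integral_add]
    · exact intervalIntegral.integral_congr fun x _ => by ring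
    all_goals exact Continuous.intervalIntegrable (by fun_prop) _ _
  have hN2 : ∫ x in a..b, cosMode a b k x * cosMode a b k x = N :=
    intervalIntegral.integral_congr fun x _ => by ring
  rw [← hJ] at hw
  rw [hN2] at hw2
  rw [i1, i2] at key
  have hgap := h.sq_lt
  -- After expansion `v` enters only through `v² N - 2 v J`; completing the square bounds this below
  -- by `-J² / N`.
  have hsq : 0 ≤ (κ ^ 2 - k ^ 2) * (N⁻¹ * (v * N - J) ^ 2) :=
    mul_nonneg (by linarith) (by positivity)
  have hexp : N⁻¹ * (v * N - J) ^ 2 = v ^ 2 * N - 2 * v * J + N⁻¹ * J ^ 2 := by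
    field_simp; ring
  rw [hexp] at hsq
  linear_combination key + hsq - 2 * v * hw + v ^ 2 * hw2

/-! ### The characteristic equations and their roots as functions of `s` -/

theorem strictMonoOn_mul_tan : StrictMonoOn (fun x : ℝ => x * Real.tan x) (Ioo 0 (π / 2)) := by
  intro x hx y hy hxy
  have h1 : Real.tan x < Real.tan y :=
    Real.tan_lt_tan_of_nonneg_of_lt_pi_div_two hx.1.le hy.2 hxy
  have h2 : 0 < Real.tan x := Real.tan_pos_of_pos_of_lt_pi_div_two hx.1 hx.2
  exact mul_lt_mul'' hxy h1 hx.1.le h2.le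

theorem hasDerivAt_mul_tan {x : ℝ} (h : Real.cos x ≠ 0) :
    HasDerivAt (fun x : ℝ => x * Real.tan x)
      ((x + Real.sin x * Real.cos x) / Real.cos x ^ 2) x := by
  refine ((hasDerivAt_id x).mul (Real.hasDerivAt_tan h)).congr_deriv ?_
  rw [Real.tan_eq_sin_div_cos]
  simp only [id]
  field_simp
  ring

theorem hasDerivAt_neg_mul_cot {y : ℝ} (h : Real.sin y ≠ 0) :
    HasDerivAt (fun y : ℝ => -(y * (Real.cos y / Real.sin y)))
      ((y - Real.sin y * Real.cos y) / Real.sin y ^ 2) y := by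
  refine ((hasDerivAt_id y).mul ((Real.hasDerivAt_cos y).div (Real.hasDerivAt_sin y) h)).neg
    |>.congr_deriv ?_
  have hsc := Real.sin_sq_add_cos_sq y
  simp only [id, Pi.div_apply]
  field_simp
  linear_combination y * hsc

theorem sub_sin_mul_cos_pos {y : ℝ} (hy : 0 < y) : 0 < y - Real.sin y * Real.cos y := by
  have h : Real.sin (2 * y) < 2 * y := Real.sin_lt (by linarith)
  rw [Real.sin_two_mul] at h
  linarith

theorem strictMonoOn_neg_mul_cot :
    StrictMonoOn (fun y : ℝ => -(y * (Real.cos y / Real.sin y))) (Ioo (π / 2) π) := by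
  have hpi := Real.pi_pos
  have hs : ∀ y ∈ Ioo (π / 2) π, 0 < Real.sin y := fun y hy =>
    Real.sin_pos_of_pos_of_lt_pi (by linarith [hy.1]) hy.2
  refine strictMonoOn_of_deriv_pos (convex_Ioo _ _) (fun y hy =>
    (hasDerivAt_neg_mul_cot (hs y hy).ne').continuousAt.continuousWithinAt) fun y hy => ?_
  rw [interior_Ioo] at hy
  rw [(hasDerivAt_neg_mul_cot (hs y hy).ne').deriv]
  exact div_pos (sub_sin_mul_cos_pos (by linarith [hy.1])) (pow_pos (hs y hy) 2)

theorem exists_mul_tan_eq {s : ℝ} (hs : 0 < s) : ∃ x ∈ Ioo 0 (π / 2), x * Real.tan x = s := by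
  have hpi := Real.pi_pos
  -- Multiplying by `cos x` removes the pole of `tan` at `π / 2`, so the intermediate value theorem
  -- applies on the closed interval.
  have hc : ContinuousOn (fun x : ℝ => x * Real.sin x - s * Real.cos x) (Icc 0 (π / 2)) := by
    fun_prop
  have h0 := intermediate_value_Ioo (by linarith : (0 : ℝ) ≤ π / 2) hc
  obtain ⟨x, hx, hx'⟩ := h0 (show (0 : ℝ) ∈ Ioo _ _ by simp; constructor <;> linarith)
  have hcos : 0 < Real.cos x := Real.cos_pos_of_mem_Ioo ⟨by linarith [hx.1], hx.2⟩
  refine ⟨x, hx, ?_⟩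
  rw [Real.tan_eq_sin_div_cos, mul_div_assoc', div_eq_iff hcos.ne']
  simp only at hx'
  linarith

theorem exists_neg_mul_cot_eq {s : ℝ} (hs : 0 < s) :
    ∃ y ∈ Ioo (π / 2) π, -(y * (Real.cos y / Real.sin y)) = s := by
  have hpi := Real.pi_pos
  have hc : ContinuousOn (fun y : ℝ => s * Real.sin y + y * Real.cos y) (Icc (π / 2) π) := by
    fun_prop
  have h0 := intermediate_value_Ioo' (by linarith : π / 2 ≤ π) hc
  obtain ⟨y, hy, hy'⟩ := h0 (show (0 : ℝ) ∈ Ioo _ _ by simp; constructor <;> linarith)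
  have hsin : 0 < Real.sin y := Real.sin_pos_of_pos_of_lt_pi (by linarith [hy.1]) hy.2
  refine ⟨y, hy, ?_⟩
  rw [mul_div_assoc', neg_eq_iff_eq_neg, div_eq_iff hsin.ne']
  simp only at hy'
  linarith

/-- The solution in `(0, π / 2)` of `x * tan x = s`. -/
def evenRoot (s : ℝ) : ℝ := if hs : 0 < s then (exists_mul_tan_eq hs).choose else 0

/-- The solution in `(π / 2, π)` of `-y * cot y = s`. -/
def oddRoot (s : ℝ) : ℝ := if hs : 0 < s then (exists_neg_mul_cot_eq hs).choose else 0

theorem evenRoot_mem {s : ℝ} (hs : 0 < s) : evenRoot s ∈ Ioo 0 (π / 2) := by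
  rw [evenRoot, dif_pos hs]; exact (exists_mul_tan_eq hs).choose_spec.1

theorem evenRoot_eq {s : ℝ} (hs : 0 < s) : evenRoot s * Real.tan (evenRoot s) = s := by
  rw [evenRoot, dif_pos hs]; exact (exists_mul_tan_eq hs).choose_spec.2

theorem oddRoot_mem {s : ℝ} (hs : 0 < s) : oddRoot s ∈ Ioo (π / 2) π := by
  rw [oddRoot, dif_pos hs]; exact (exists_neg_mul_cot_eq hs).choose_spec.1

theorem oddRoot_eq {s : ℝ} (hs : 0 < s) :
    -(oddRoot s * (Real.cos (oddRoot s) / Real.sin (oddRoot s))) = s := by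
  rw [oddRoot, dif_pos hs]; exact (exists_neg_mul_cot_eq hs).choose_spec.2

theorem strictMonoOn_evenRoot : StrictMonoOn evenRoot (Ioi 0) := by
  intro s hs t ht hst
  rw [← strictMonoOn_mul_tan.lt_iff_lt (evenRoot_mem hs) (evenRoot_mem ht)]
  simpa only [evenRoot_eq hs, evenRoot_eq ht] using hst

theorem strictMonoOn_oddRoot : StrictMonoOn oddRoot (Ioi 0) := by
  intro s hs t ht hst
  rw [← strictMonoOn_neg_mul_cot.lt_iff_lt (oddRoot_mem hs) (oddRoot_mem ht)]
  simpa only [oddRoot_eq hs, oddRoot_eq ht] using hst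

/-- A strictly monotone function whose image is a neighbourhood of a value is continuous there;
`hasDerivAt_evenRoot` needs this to differentiate the root as a local inverse. -/
theorem evenRoot_image : evenRoot '' Ioi 0 = Ioo 0 (π / 2) := by
  apply Subset.antisymm
  · rintro _ ⟨s, hs, rfl⟩; exact evenRoot_mem hs
  · intro x hx
    have hs : 0 < x * Real.tan x :=
      mul_pos hx.1 (Real.tan_pos_of_pos_of_lt_pi_div_two hx.1 hx.2)
    exact ⟨x * Real.tan x, hs, strictMonoOn_mul_tan.injOn (evenRoot_mem hs) hx (evenRoot_eq hs)⟩

theorem oddRoot_image : oddRoot '' Ioi 0 = Ioo (π / 2) π := by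
  have hpi := Real.pi_pos
  apply Subset.antisymm
  · rintro _ ⟨s, hs, rfl⟩; exact oddRoot_mem hs
  · intro y hy
    have h1 : Real.cos y < 0 := Real.cos_neg_of_pi_div_two_lt_of_lt hy.1 (by linarith [hy.2])
    have h2 : 0 < Real.sin y := Real.sin_pos_of_pos_of_lt_pi (by linarith [hy.1]) hy.2
    have hs : 0 < -(y * (Real.cos y / Real.sin y)) := by
      have := mul_neg_of_pos_of_neg (by linarith [hy.1] : 0 < y) (div_neg_of_neg_of_pos h1 h2)
      linarith
    exact ⟨_, hs, strictMonoOn_neg_mul_cot.injOn (oddRoot_mem hs) hy (oddRoot_eq hs)⟩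

theorem hasDerivAt_evenRoot {s : ℝ} (hs : 0 < s) :
    HasDerivAt evenRoot ((evenRoot s + Real.sin (evenRoot s) * Real.cos (evenRoot s)) /
      Real.cos (evenRoot s) ^ 2)⁻¹ s := by
  have hpi := Real.pi_pos
  have hx := evenRoot_mem hs
  have hcos : 0 < Real.cos (evenRoot s) := Real.cos_pos_of_mem_Ioo ⟨by linarith [hx.1], hx.2⟩
  have hsin : 0 < Real.sin (evenRoot s) :=
    Real.sin_pos_of_pos_of_lt_pi hx.1 (by linarith [hx.2])
  refine HasDerivAt.of_local_left_inverse ?_ (hasDerivAt_mul_tan hcos.ne') ?_ ?_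
  · refine strictMonoOn_evenRoot.continuousAt_of_image_mem_nhds (Ioi_mem_nhds hs) ?_
    rw [evenRoot_image]; exact Ioo_mem_nhds hx.1 hx.2
  · have := hx.1; positivity
  · filter_upwards [Ioi_mem_nhds hs] with u hu using evenRoot_eq hu

theorem hasDerivAt_oddRoot {s : ℝ} (hs : 0 < s) :
    HasDerivAt oddRoot ((oddRoot s - Real.sin (oddRoot s) * Real.cos (oddRoot s)) /
      Real.sin (oddRoot s) ^ 2)⁻¹ s := by
  have hpi := Real.pi_pos
  have hx := oddRoot_mem hs
  have hsin : 0 < Real.sin (oddRoot s) :=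
    Real.sin_pos_of_pos_of_lt_pi (by linarith [hx.1]) hx.2
  refine HasDerivAt.of_local_left_inverse ?_ (hasDerivAt_neg_mul_cot hsin.ne') ?_ ?_
  · refine strictMonoOn_oddRoot.continuousAt_of_image_mem_nhds (Ioi_mem_nhds hs) ?_
    rw [oddRoot_image]; exact Ioo_mem_nhds hx.1 hx.2
  · have := sub_sin_mul_cos_pos (show 0 < oddRoot s by linarith [hx.1])
    positivity
  · filter_upwards [Ioi_mem_nhds hs] with u hu using oddRoot_eq hu

/-! ### Convexity of the first eigenvalue and monotonicity of the gap -/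

/-- The first Robin eigenvalue of an interval, in units of `β ^ 2`, as a function of `s = β t`
with `t` the half-length. -/
def scaledFirst (s : ℝ) : ℝ := (evenRoot s / s) ^ 2

/-- The spectral gap of an interval, in the same units. -/
def scaledGap (s : ℝ) : ℝ := (oddRoot s / s) ^ 2 - (evenRoot s / s) ^ 2

theorem scaledFirst_pos {s : ℝ} (hs : 0 < s) : 0 < scaledFirst s :=
  pow_pos (div_pos (evenRoot_mem hs).1 hs) 2

theorem evenRoot_add_pos {s : ℝ} (hs : 0 < s) :
    0 < evenRoot s + Real.sin (evenRoot s) * Real.cos (evenRoot s) := by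
  have hpi := Real.pi_pos
  have hx := evenRoot_mem hs
  have hcos : 0 < Real.cos (evenRoot s) := Real.cos_pos_of_mem_Ioo ⟨by linarith [hx.1], hx.2⟩
  have hsin : 0 < Real.sin (evenRoot s) :=
    Real.sin_pos_of_pos_of_lt_pi hx.1 (by linarith [hx.2])
  have := hx.1
  positivity

/-- With `x = evenRoot s`, the equation `s cos x = x sin x` collapses `x' s - x` to `-x² / (x + sin
x cos x)`. The remaining factor depends on `x` alone. -/
theorem hasDerivAt_scaledFirst {s : ℝ} (hs : 0 < s) :
    HasDerivAt scaledFirst (-(2 / s ^ 3) * (evenRoot s ^ 3 /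
      (evenRoot s + Real.sin (evenRoot s) * Real.cos (evenRoot s)))) s := by
  have hx := evenRoot_mem hs
  have hcos : 0 < Real.cos (evenRoot s) :=
    Real.cos_pos_of_mem_Ioo ⟨by linarith [hx.1, Real.pi_pos], hx.2⟩
  have hp := evenRoot_add_pos hs
  refine (((hasDerivAt_evenRoot hs).div (hasDerivAt_id s) hs.ne').pow 2).congr_deriv ?_
  have he := evenRoot_eq hs
  rw [Real.tan_eq_sin_div_cos, mul_div_assoc', div_eq_iff hcos.ne'] at he
  have hs0 : s ≠ 0 := hs.ne'
  simp only [id, Pi.div_apply, Nat.cast_ofNat, Nat.add_one_sub_one, pow_one, inv_div, mul_one]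
  generalize Real.cos (evenRoot s) = c at *
  generalize Real.sin (evenRoot s) = t at *
  generalize evenRoot s = x at *
  have hp0 : x + c * t ≠ 0 := by rw [mul_comm c t]; exact hp.ne'
  field_simp
  linear_combination (-c * x) * he

theorem hasDerivAt_scaledSecond {s : ℝ} (hs : 0 < s) :
    HasDerivAt (fun s => (oddRoot s / s) ^ 2) (-(2 / s ^ 3) * (oddRoot s ^ 3 /
      (oddRoot s - Real.sin (oddRoot s) * Real.cos (oddRoot s)))) s := by
  have hx := oddRoot_mem hs
  have hsin : 0 < Real.sin (oddRoot s) :=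
    Real.sin_pos_of_pos_of_lt_pi (by linarith [hx.1, Real.pi_pos]) hx.2
  have hp := sub_sin_mul_cos_pos (show 0 < oddRoot s by linarith [hx.1, Real.pi_pos])
  refine (((hasDerivAt_oddRoot hs).div (hasDerivAt_id s) hs.ne').pow 2).congr_deriv ?_
  have he := oddRoot_eq hs
  rw [mul_div_assoc', neg_eq_iff_eq_neg, div_eq_iff hsin.ne'] at he
  have hs0 : s ≠ 0 := hs.ne'
  simp only [id, Pi.div_apply, Nat.cast_ofNat, Nat.add_one_sub_one, pow_one, inv_div, mul_one]
  generalize Real.cos (oddRoot s) = c at *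
  generalize Real.sin (oddRoot s) = t at *
  generalize oddRoot s = x at *
  have hp0 : x - t * c ≠ 0 := hp.ne'
  field_simp
  linear_combination (t * x) * he

/-- Substituting `s = x tan x` turns the derivative into `-2 cot³ x / (x + sin x cos x)`. It
increases with `x`, hence with `s`, because `tan x` and `x + sin x cos x` are positive and
increasing. -/
theorem convexOn_scaledFirst : ConvexOn ℝ (Ioi 0) scaledFirst := by
  refine MonotoneOn.convexOn_of_deriv (convex_Ioi 0)
    (fun s hs => (hasDerivAt_scaledFirst hs).continuousAt.continuousWithinAt) ?_ ?_
  · rw [interior_Ioi]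
    exact fun s hs => (hasDerivAt_scaledFirst hs).differentiableAt.differentiableWithinAt
  · rw [interior_Ioi]
    intro s hs t ht hst
    rw [(hasDerivAt_scaledFirst hs).deriv, (hasDerivAt_scaledFirst ht).deriv]
    have key : ∀ u : ℝ, 0 < u → -(2 / u ^ 3) * (evenRoot u ^ 3 /
        (evenRoot u + Real.sin (evenRoot u) * Real.cos (evenRoot u))) =
        -2 * ((Real.tan (evenRoot u))⁻¹ ^ 3 *
          (evenRoot u + Real.sin (evenRoot u) * Real.cos (evenRoot u))⁻¹) := by
      intro u hu
      have h1 := evenRoot_add_pos hu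
      have h2 := evenRoot_eq hu
      have h3 := (evenRoot_mem hu).1
      have h4 : 0 < Real.tan (evenRoot u) :=
        Real.tan_pos_of_pos_of_lt_pi_div_two h3 (evenRoot_mem hu).2
      rw [show -(2 / u ^ 3) = -2 / (evenRoot u * Real.tan (evenRoot u)) ^ 3 by rw [h2]; ring]
      field_simp
    rw [key s hs, key t ht]
    have hxy : evenRoot s ≤ evenRoot t := strictMonoOn_evenRoot.monotoneOn hs ht hst
    have hx := evenRoot_mem hs
    have hy := evenRoot_mem ht
    have h1 : 0 < Real.tan (evenRoot s) := Real.tan_pos_of_pos_of_lt_pi_div_two hx.1 hx.2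
    have h2 : Real.tan (evenRoot s) ≤ Real.tan (evenRoot t) := by
      rcases hxy.eq_or_lt with h | h
      · rw [h]
      · exact (Real.tan_lt_tan_of_nonneg_of_lt_pi_div_two hx.1.le hy.2 h).le
    have h3 : evenRoot s + Real.sin (evenRoot s) * Real.cos (evenRoot s) ≤
        evenRoot t + Real.sin (evenRoot t) * Real.cos (evenRoot t) := by
      have hm : Monotone (fun x : ℝ => x + Real.sin x * Real.cos x) := by
        have hd : ∀ x : ℝ, HasDerivAt (fun x : ℝ => x + Real.sin x * Real.cos x)
            (1 + (Real.cos x * Real.cos x + Real.sin x * -Real.sin x)) x := fun x =>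
          (hasDerivAt_id x).add ((Real.hasDerivAt_sin x).mul (Real.hasDerivAt_cos x))
        refine monotone_of_deriv_nonneg (fun x => (hd x).differentiableAt) fun x => ?_
        rw [(hd x).deriv]
        nlinarith [Real.sin_sq_add_cos_sq x, sq_nonneg (Real.cos x)]
      exact hm hxy
    have h4 := evenRoot_add_pos hs
    have : (Real.tan (evenRoot t))⁻¹ ^ 3 *
          (evenRoot t + Real.sin (evenRoot t) * Real.cos (evenRoot t))⁻¹ ≤
        (Real.tan (evenRoot s))⁻¹ ^ 3 *
          (evenRoot s + Real.sin (evenRoot s) * Real.cos (evenRoot s))⁻¹ := by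
      have := h1.trans_le h2
      have := evenRoot_add_pos ht
      gcongr
    linarith

/-- The derivative is `-2 / s³` times `y³ / (y - sin y cos y) - x³ / (x + sin x cos x)`. The
constant `π² / 4`, the value of both quotients at `π / 2`, separates them. -/
theorem strictAntiOn_scaledGap : StrictAntiOn scaledGap (Ioi 0) := by
  have hpi := Real.pi_pos
  have hd : ∀ s : ℝ, 0 < s → HasDerivAt scaledGap _ s := fun s hs =>
    (hasDerivAt_scaledSecond hs).sub (hasDerivAt_scaledFirst hs)
  refine strictAntiOn_of_deriv_neg (convex_Ioi 0)
    (fun s hs => (hd s hs).continuousAt.continuousWithinAt) ?_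
  rw [interior_Ioi]
  intro s hs
  rw [(hd s hs).deriv, ← mul_sub]
  refine mul_neg_of_neg_of_pos (neg_neg_of_pos (by have := mem_Ioi.1 hs; positivity)) ?_
  have hx := evenRoot_mem hs
  have hy := oddRoot_mem hs
  have hcos : 0 < Real.cos (evenRoot s) := Real.cos_pos_of_mem_Ioo ⟨by linarith [hx.1], hx.2⟩
  have hsin : 0 < Real.sin (evenRoot s) :=
    Real.sin_pos_of_pos_of_lt_pi hx.1 (by linarith [hx.2])
  have h1 : evenRoot s ^ 3 / (evenRoot s + Real.sin (evenRoot s) * Real.cos (evenRoot s)) <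
      π ^ 2 / 4 := by
    rw [div_lt_iff₀ (evenRoot_add_pos hs)]
    have a1 : evenRoot s ^ 2 < π ^ 2 / 4 := by nlinarith [hx.1, hx.2]
    have a2 : evenRoot s * evenRoot s ^ 2 < evenRoot s * (π ^ 2 / 4) :=
      mul_lt_mul_of_pos_left a1 hx.1
    have a3 : 0 < π ^ 2 / 4 * (Real.sin (evenRoot s) * Real.cos (evenRoot s)) := by positivity
    nlinarith
  have h2 : π ^ 2 / 4 ≤ oddRoot s ^ 3 / (oddRoot s - Real.sin (oddRoot s) * Real.cos (oddRoot s)) := by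
    rw [le_div_iff₀ (sub_sin_mul_cos_pos (by linarith [hy.1]))]
    generalize oddRoot s = y at *
    -- Since `sin (2y - π) = -2 sin y cos y`, this gives `-sin y cos y ≤ y - π / 2`.
    have hz : Real.sin (2 * (y - π / 2)) ≤ 2 * (y - π / 2) :=
      Real.sin_le (by linarith [hy.1])
    rw [show 2 * (y - π / 2) = 2 * y - π by ring, Real.sin_sub_pi, Real.sin_two_mul] at hz
    have b1 : y - Real.sin y * Real.cos y ≤ 2 * y - π / 2 := by linarith
    have b2 : π ^ 2 / 4 * (2 * y - π / 2) ≤ y ^ 3 := by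
      obtain ⟨z, hz0, rfl⟩ : ∃ z : ℝ, 0 ≤ z ∧ y = π / 2 + z := ⟨y - π / 2, by linarith [hy.1], by ring⟩
      have : 0 ≤ z * π ^ 2 / 4 + 3 * z ^ 2 * π / 2 + z ^ 3 := by positivity
      nlinarith
    have := mul_le_mul_of_nonneg_left b1 (by positivity : 0 ≤ π ^ 2 / 4)
    linarith
  linarith

/-- The frequencies on an interval of half-length `t`. -/
theorem robinFreq_of_pos {β t : ℝ} (hβ : 0 < β) (ht : 0 < t) :
    RobinFreq β t (evenRoot (β * t) / t) (oddRoot (β * t) / t) := by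
  have hpi := Real.pi_pos
  have hs : 0 < β * t := mul_pos hβ ht
  have hx := evenRoot_mem hs
  have hy := oddRoot_mem hs
  have ex := evenRoot_eq hs
  have ey := oddRoot_eq hs
  have hcos : 0 < Real.cos (evenRoot (β * t)) :=
    Real.cos_pos_of_mem_Ioo ⟨by linarith [hx.1], hx.2⟩
  have hsin : 0 < Real.sin (oddRoot (β * t)) :=
    Real.sin_pos_of_pos_of_lt_pi (by linarith [hy.1]) hy.2
  rw [Real.tan_eq_sin_div_cos, mul_div_assoc', div_eq_iff hcos.ne'] at ex
  rw [mul_div_assoc', neg_eq_iff_eq_neg, div_eq_iff hsin.ne'] at ey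
  refine ⟨ht, div_pos hx.1 ht, ?_, ?_, ?_, ?_, ?_⟩
  · rw [div_mul_cancel₀ _ ht.ne']; exact hx.2
  · rw [div_mul_cancel₀ _ ht.ne', div_mul_eq_mul_div, div_eq_iff ht.ne']; linarith
  · rw [div_mul_cancel₀ _ ht.ne']; exact hy.1
  · rw [div_mul_cancel₀ _ ht.ne']; exact hy.2
  · rw [div_mul_cancel₀ _ ht.ne', div_mul_eq_mul_div, div_eq_iff ht.ne']; linarith

/-! ### Continuous functions as a dense subspace of `L²` -/

section ContinuousL2

variable {X : Type} [PseudoMetricSpace X] [ProperSpace X] [MeasureSpace X] [BorelSpace X]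
  [IsFiniteMeasureOnCompacts (volume : Measure X)]

theorem Continuous.memLp_of_isBounded {s : Set X} (hs : Bornology.IsBounded s) {F : X → ℝ}
    (hF : Continuous F) : MemLp F 2 ((volume : Measure X).restrict s) := by
  have hK : IsCompact (closure s) := hs.isCompact_closure
  obtain ⟨C, hC⟩ := hK.exists_bound_of_continuousOn hF.continuousOn
  have : IsFiniteMeasure ((volume : Measure X).restrict (closure s)) :=
    ⟨by rw [Measure.restrict_apply_univ]; exact hK.measure_lt_top⟩
  have : MemLp F 2 ((volume : Measure X).restrict (closure s)) := by
    refine MemLp.of_bound hF.aestronglyMeasurable C ?_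
    exact (ae_restrict_mem isClosed_closure.measurableSet).mono hC
  exact this.mono_measure (Measure.restrict_mono subset_closure le_rfl)

/-- The class in `L²` of a continuous function. -/
def ofCont {s : Set X} (hs : Bornology.IsBounded s) : C(X, ℝ) →ₗ[ℝ] L2On s where
  toFun F := (F.continuous.memLp_of_isBounded hs).toLp F
  map_add' _ _ := rfl
  map_smul' _ _ := rfl

theorem coeFn_ofCont {s : Set X} (hs : Bornology.IsBounded s) (F : C(X, ℝ)) :
    ofCont hs F =ᵐ[(volume : Measure X).restrict s] F :=
  MemLp.coeFn_toLp (F.continuous.memLp_of_isBounded hs)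

theorem inner_eq_integral {X : Type} [MeasureSpace X] {s : Set X} (u v : L2On s) :
    ⟪u, v⟫_ℝ = ∫ z in s, u z * v z := by
  rw [L2.inner_def]
  refine integral_congr_ae (Eventually.of_forall fun z => ?_)
  simp [mul_comm]

theorem norm_sq_eq_integral {X : Type} [MeasureSpace X] {s : Set X} (u : L2On s) :
    ‖u‖ ^ 2 = ∫ z in s, u z ^ 2 := by
  rw [← real_inner_self_eq_norm_sq, inner_eq_integral]
  simp only [sq]

theorem inner_ofCont {s : Set X} (hs : Bornology.IsBounded s) (u : L2On s) (F : C(X, ℝ)) :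
    ⟪u, ofCont hs F⟫_ℝ = ∫ z in s, u z * F z := by
  rw [inner_eq_integral]
  refine integral_congr_ae ?_
  filter_upwards [coeFn_ofCont hs F] with z hz
  rw [hz]

theorem inner_ofCont_ofCont {s : Set X} (hs : Bornology.IsBounded s) (F G : C(X, ℝ)) :
    ⟪ofCont hs F, ofCont hs G⟫_ℝ = ∫ z in s, F z * G z := by
  rw [inner_ofCont]
  refine integral_congr_ae ?_
  filter_upwards [coeFn_ofCont hs F] with z hz
  rw [hz]

theorem norm_sq_ofCont {s : Set X} (hs : Bornology.IsBounded s) (F : C(X, ℝ)) :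
    ‖ofCont hs F‖ ^ 2 = ∫ z in s, F z ^ 2 := by
  rw [← real_inner_self_eq_norm_sq, inner_ofCont_ofCont]
  simp only [sq]

theorem denseRange_ofCont [SecondCountableTopology X] {s : Set X} (hs : Bornology.IsBounded s) :
    DenseRange (ofCont hs) := by
  have : IsFiniteMeasure ((volume : Measure X).restrict s) :=
    ⟨by rw [Measure.restrict_apply_univ]; exact hs.measure_lt_top⟩
  refine (BoundedContinuousFunction.toLp_denseRange ℝ ((volume : Measure X).restrict s)
    (p := 2) ℝ (by simp)).mono ?_
  rintro _ ⟨f, rfl⟩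
  exact ⟨f.toContinuousMap, Lp.ext ((coeFn_ofCont hs _).trans
    (BoundedContinuousFunction.coeFn_toLp 2 _ ℝ f).symm)⟩

theorem norm_ofCont_le {s : Set X} (hs : Bornology.IsBounded s) (hm : MeasurableSet s)
    (F : C(X, ℝ)) {ε : ℝ} (hε : 0 ≤ ε) (h : ∀ z ∈ s, |F z| ≤ ε) :
    ‖ofCont hs F‖ ≤ Real.sqrt ((volume : Measure X).real s) * ε := by
  have h1 : ‖ofCont hs F‖ ^ 2 ≤ (Real.sqrt ((volume : Measure X).real s) * ε) ^ 2 := by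
    rw [norm_sq_ofCont, mul_pow, Real.sq_sqrt measureReal_nonneg]
    have : ∫ z in s, F z ^ 2 ≤ ∫ z in s, ε ^ 2 := by
      have hfin : (volume : Measure X) s ≠ ⊤ := hs.measure_lt_top.ne
      refine setIntegral_mono_on ?_ (integrableOn_const hfin) hm fun z hz => ?_
      · exact (F.continuous.memLp_of_isBounded hs).integrable_sq
      · exact sq_le_sq' (by linarith [(abs_le.1 (h z hz)).1]) (abs_le.1 (h z hz)).2
    simpa using this
  exact le_of_sq_le_sq h1 (by positivity) 

end ContinuousL2

theorem isBounded_rect (a b c d : ℝ) : Bornology.IsBounded (Ioo a b ×ˢ Ioo c d) :=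
  (Metric.isBounded_Ioo a b).prod (Metric.isBounded_Ioo c d)

theorem Rectangle.isBounded_domain (R : Rectangle) : Bornology.IsBounded R.domain :=
  isBounded_rect _ _ _ _

theorem Rectangle.measurableSet_domain (R : Rectangle) : MeasurableSet R.domain :=
  measurableSet_Ioo.prod measurableSet_Ioo

theorem setIntegral_Ioo_eq {a b : ℝ} (hab : a ≤ b) (f : ℝ → ℝ) :
    ∫ x in Ioo a b, f x = ∫ x in a..b, f x := by
  rw [intervalIntegral.integral_of_le hab, integral_Ioc_eq_integral_Ioo]

theorem integrableOn_rect {a b c d : ℝ} {F : ℝ × ℝ → ℝ} (hF : Continuous F) :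
    IntegrableOn F (Ioo a b ×ˢ Ioo c d) := by
  have : IsFiniteMeasure ((volume : Measure (ℝ × ℝ)).restrict (Ioo a b ×ˢ Ioo c d)) :=
    ⟨by rw [Measure.restrict_apply_univ]; exact (isBounded_rect a b c d).measure_lt_top⟩
  exact (hF.memLp_of_isBounded (isBounded_rect a b c d)).integrable (by norm_num)

theorem integral_rect {a b c d : ℝ} (hab : a ≤ b) (hcd : c ≤ d) {F : ℝ × ℝ → ℝ}
    (hF : Continuous F) :
    ∫ z in Ioo a b ×ˢ Ioo c d, F z = ∫ x in a..b, ∫ y in c..d, F (x, y) := by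
  rw [Measure.volume_eq_prod, setIntegral_prod _ (integrableOn_rect hF), setIntegral_Ioo_eq hab]
  simp only [setIntegral_Ioo_eq hcd]

theorem integral_rect_swap {a b c d : ℝ} (F : ℝ × ℝ → ℝ) :
    ∫ z in Ioo c d ×ˢ Ioo a b, F z.swap = ∫ z in Ioo a b ×ˢ Ioo c d, F z :=
  setIntegral_prod_swap _ _ F

theorem integral_rect' {a b c d : ℝ} (hab : a ≤ b) (hcd : c ≤ d) {F : ℝ × ℝ → ℝ}
    (hF : Continuous F) :
    ∫ z in Ioo a b ×ˢ Ioo c d, F z = ∫ y in c..d, ∫ x in a..b, F (x, y) := by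
  rw [← integral_rect_swap]
  exact integral_rect hcd hab (hF.comp continuous_swap)

/-! ### Product functions and the Robin problem in one variable -/

/-- Finite sums of products `p(x) q(y)` of `C¹` functions. -/
def prodSpan : Submodule ℝ C(ℝ × ℝ, ℝ) :=
  Submodule.span ℝ {F | ∃ p q : ℝ → ℝ, ContDiff ℝ 1 p ∧ ContDiff ℝ 1 q ∧
    ∀ z, F z = p z.1 * q z.2}

/-- Stone-Weierstrass for polynomials in the two coordinates: every monomial is a product of smooth
one-variable functions. -/
theorem exists_prodSpan_near (F : C(ℝ × ℝ, ℝ)) {s : Set (ℝ × ℝ)} (hs : Bornology.IsBounded s)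
    {ε : ℝ} (hε : 0 < ε) : ∃ G ∈ prodSpan, ∀ z ∈ s, |F z - G z| ≤ ε := by
  let X : C(ℝ × ℝ, ℝ) := ⟨Prod.fst, continuous_fst⟩
  let Y : C(ℝ × ℝ, ℝ) := ⟨Prod.snd, continuous_snd⟩
  let A : Subalgebra ℝ C(ℝ × ℝ, ℝ) := Algebra.adjoin ℝ {X, Y}
  have hA : A.SeparatesPoints := by
    intro z w hzw
    by_cases h : z.1 = w.1
    · exact ⟨Y, ⟨Y, Algebra.subset_adjoin (by simp), rfl⟩, fun h2 => hzw (Prod.ext h h2)⟩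
    · exact ⟨X, ⟨X, Algebra.subset_adjoin (by simp), rfl⟩, h⟩
  obtain ⟨G, hG, hGF⟩ :=
    ContinuousMap.exists_mem_subalgebra_near_continuous_of_isCompact_of_separatesPoints hA F
      hs.isCompact_closure hε
  refine ⟨G, ?_, fun z hz => ?_⟩
  · have : Subalgebra.toSubmodule A ≤ prodSpan := by
      rw [Algebra.adjoin_eq_span, prodSpan]
      refine Submodule.span_mono fun H hH => ?_
      induction hH using Submonoid.closure_induction with
      | mem H hH =>
        rcases hH with rfl | rfl
        · exact ⟨id, fun _ => 1, contDiff_id, contDiff_const, fun z => by simp [X]⟩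
        · exact ⟨fun _ => 1, id, contDiff_const, contDiff_id, fun z => by simp [Y]⟩
      | one => exact ⟨fun _ => 1, fun _ => 1, contDiff_const, contDiff_const, fun z => by simp⟩
      | mul H H' _ _ h h' =>
        obtain ⟨p, q, hp, hq, e⟩ := h
        obtain ⟨p', q', hp', hq', e'⟩ := h'
        exact ⟨fun x => p x * p' x, fun y => q y * q' y, hp.mul hp', hq.mul hq', fun z => by
          rw [ContinuousMap.mul_apply, e, e']; ring⟩
    exact this hG
  · rw [abs_sub_comm]; exact (hGF z (subset_closure hz)).le

theorem exists_prodSpan_norm_lt {s : Set (ℝ × ℝ)} (hs : Bornology.IsBounded s)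
    (hm : MeasurableSet s) (v : L2On s) {ε : ℝ} (hε : 0 < ε) :
    ∃ G ∈ prodSpan, ‖ofCont hs G - v‖ < ε := by
  obtain ⟨F, hF⟩ := (denseRange_ofCont hs).exists_dist_lt v (half_pos hε)
  set V := Real.sqrt ((volume : Measure (ℝ × ℝ)).real s) with hV
  have hV0 : 0 ≤ V := Real.sqrt_nonneg _
  obtain ⟨G, hG, hGF⟩ := exists_prodSpan_near F hs (ε := ε / 2 / (V + 1)) (by positivity)
  refine ⟨G, hG, ?_⟩
  have h1 : ‖ofCont hs (F - G)‖ ≤ V * (ε / 2 / (V + 1)) :=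
    norm_ofCont_le hs hm _ (by positivity) fun z hz => hGF z hz
  have h2 : V * (ε / 2 / (V + 1)) ≤ ε / 2 := by
    rw [mul_div_assoc', div_le_iff₀ (by positivity)]; nlinarith
  rw [map_sub] at h1
  rw [dist_eq_norm] at hF
  calc ‖ofCont hs G - v‖ = ‖-(v - ofCont hs F) - (ofCont hs F - ofCont hs G)‖ := by
        congr 1; abel
    _ ≤ ‖-(v - ofCont hs F)‖ + ‖ofCont hs F - ofCont hs G‖ := norm_sub_le _ _
    _ < ε := by rw [norm_neg]; linarith

/-- `φ` solves `-∂ₓ∂ₓφ = h` with Robin conditions at `x = a` and `x = b`; `φ₁ = ∂ₓφ`. -/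
structure RobinSol (β a b : ℝ) (h φ φ₁ : ℝ × ℝ → ℝ) : Prop where
  contDiff : ContDiff ℝ 1 φ
  contDiff' : ContDiff ℝ 1 φ₁
  hasDeriv : ∀ x y, HasDerivAt (fun x => φ (x, y)) (φ₁ (x, y)) x
  hasDeriv' : ∀ x y, HasDerivAt (fun x => φ₁ (x, y)) (-h (x, y)) x
  left : ∀ y, φ₁ (a, y) = β * φ (a, y)
  right : ∀ y, φ₁ (b, y) = -(β * φ (b, y))

theorem exists_robin_ode {β a b : ℝ} (hβ : 0 < β) (hab : a < b) {p : ℝ → ℝ}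
    (hp : Continuous p) : ∃ P P₁ : ℝ → ℝ, (∀ x, HasDerivAt P (P₁ x) x) ∧
      (∀ x, HasDerivAt P₁ (-p x) x) ∧ P₁ a = β * P a ∧ P₁ b = -(β * P b) := by
  set I : ℝ → ℝ := fun x => ∫ s in a..x, p s with hI
  have dI : ∀ x, HasDerivAt I (p x) x := fun x => hp.integral_hasStrictDerivAt a x |>.hasDerivAt
  have cI : Continuous I := continuous_iff_continuousAt.2 fun x => (dI x).continuousAt
  set J : ℝ → ℝ := fun x => ∫ s in a..x, I s with hJ
  have dJ : ∀ x, HasDerivAt J (I x) x := fun x => cI.integral_hasStrictDerivAt a x |>.hasDerivAt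
  -- The slope at `a`. The condition at `a` makes `B / β` the value there, and the condition at `b`
  -- then determines `B`.
  set B := (I b + β * J b) / (2 + β * (b - a)) with hB
  have hden : 2 + β * (b - a) ≠ 0 := by
    have := mul_pos hβ (sub_pos.2 hab); positivity
  have hB' : B * (2 + β * (b - a)) = I b + β * J b := by rw [hB]; field_simp
  refine ⟨fun x => B / β + B * (x - a) - J x, fun x => B - I x, fun x => ?_, fun x => ?_, ?_, ?_⟩
  · have := ((((hasDerivAt_id x).sub_const a).const_mul B).const_add (B / β)).sub (dJ x)
    exact this.congr_deriv (by simp)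
  · simpa using (dI x).const_sub B
  · simp [hI, hJ]; field_simp
  · have : β * (B / β) = B := by field_simp
    simp only
    linear_combination hB' + this

/-- The problem is linear in `h`, and for `h = p ⊗ q` the solution is `P ⊗ q` with `P` from the ODE.
Product data make `φ` and `φ₁` of class `C¹` in both variables, as a Gauss-Green test function must
be. -/
theorem exists_robinSol {β a b : ℝ} (hβ : 0 < β) (hab : a < b) {h : C(ℝ × ℝ, ℝ)}
    (hh : h ∈ prodSpan) : ∃ φ φ₁ : ℝ × ℝ → ℝ, RobinSol β a b h φ φ₁ := by
  induction hh using Submodule.span_induction with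
  | mem F hF =>
    obtain ⟨p, q, hp, hq, e⟩ := hF
    obtain ⟨P, P₁, dP, dP₁, hl, hr⟩ := exists_robin_ode hβ hab hp.continuous
    have cP₁ : ContDiff ℝ 1 P₁ := by
      rw [contDiff_one_iff_deriv]
      refine ⟨fun x => (dP₁ x).differentiableAt, ?_⟩
      rw [show deriv P₁ = fun x => -p x from funext fun x => (dP₁ x).deriv]
      exact hp.continuous.neg
    have cP : ContDiff ℝ 1 P := by
      rw [contDiff_one_iff_deriv]
      refine ⟨fun x => (dP x).differentiableAt, ?_⟩
      rw [show deriv P = P₁ from funext fun x => (dP x).deriv]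
      exact cP₁.continuous
    refine ⟨fun z => P z.1 * q z.2, fun z => P₁ z.1 * q z.2, ?_, ?_, fun x y => ?_, fun x y => ?_,
      fun y => ?_, fun y => ?_⟩
    · fun_prop
    · fun_prop
    · exact (dP x).mul_const (q y)
    · rw [e]; simpa using (dP₁ x).mul_const (q y)
    · simp only [hl]; ring
    · simp only [hr]; ring
  | zero =>
    refine ⟨fun _ => 0, fun _ => 0, contDiff_const, contDiff_const, fun x y => ?_, fun x y => ?_,
      by simp, by simp⟩
    · exact hasDerivAt_const _ _
    · simpa using hasDerivAt_const x (0 : ℝ)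
  | add F G _ _ hF hG =>
    obtain ⟨φ, φ₁, s⟩ := hF
    obtain ⟨ψ, ψ₁, t⟩ := hG
    refine ⟨fun z => φ z + ψ z, fun z => φ₁ z + ψ₁ z, s.contDiff.add t.contDiff,
      s.contDiff'.add t.contDiff', fun x y => (s.hasDeriv x y).add (t.hasDeriv x y),
      fun x y => ((s.hasDeriv' x y).add (t.hasDeriv' x y)).congr_deriv ?_, fun y => ?_, fun y => ?_⟩
    · simp; ring
    · simp only [s.left, t.left]; ring
    · simp only [s.right, t.right]; ring
  | smul r F _ hF =>
    obtain ⟨φ, φ₁, s⟩ := hF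
    refine ⟨fun z => r * φ z, fun z => r * φ₁ z, contDiff_const.mul s.contDiff,
      contDiff_const.mul s.contDiff', fun x y => (s.hasDeriv x y).const_mul r,
      fun x y => ((s.hasDeriv' x y).const_mul r).congr_deriv ?_, fun y => ?_, fun y => ?_⟩
    · simp
    · simp only [s.left]; ring
    · simp only [s.right]; ring

namespace RobinSol

variable {β a b c d : ℝ} {h φ φ₁ : ℝ × ℝ → ℝ}

theorem slice_energy (S : RobinSol β a b h φ φ₁) (hh : Continuous h) (y : ℝ) :
    (∫ x in a..b, φ₁ (x, y) ^ 2) + β * (φ (a, y) ^ 2 + φ (b, y) ^ 2) =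
      ∫ x in a..b, φ (x, y) * h (x, y) := by
  have c1 := S.contDiff.continuous
  have c2 := S.contDiff'.continuous
  have hd : ∀ x ∈ uIcc a b, HasDerivAt (fun x => φ (x, y) * φ₁ (x, y))
      (φ₁ (x, y) ^ 2 - φ (x, y) * h (x, y)) x := fun x _ => by
    refine ((S.hasDeriv x y).mul (S.hasDeriv' x y)).congr_deriv ?_
    ring
  have hI := intervalIntegral.integral_eq_sub_of_hasDerivAt hd
    (Continuous.intervalIntegrable (by fun_prop) _ _)
  rw [intervalIntegral.integral_sub (Continuous.intervalIntegrable (by fun_prop) _ _)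
    (Continuous.intervalIntegrable (by fun_prop) _ _), S.left, S.right] at hI
  linarith

theorem energy (S : RobinSol β a b h φ φ₁) (hh : Continuous h) (hab : a ≤ b) (hcd : c ≤ d) :
    (∫ z in Ioo a b ×ˢ Ioo c d, φ₁ z ^ 2) +
        β * ((∫ y in Ioo c d, φ (a, y) ^ 2) + ∫ y in Ioo c d, φ (b, y) ^ 2) =
      ∫ z in Ioo a b ×ˢ Ioo c d, φ z * h z := by
  have c1 := S.contDiff.continuous
  have c2 := S.contDiff'.continuous
  rw [integral_rect' hab hcd (by fun_prop), integral_rect' hab hcd (by fun_prop),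
    setIntegral_Ioo_eq hcd, setIntegral_Ioo_eq hcd,
    ← intervalIntegral.integral_add (Continuous.intervalIntegrable (by fun_prop) _ _)
      (Continuous.intervalIntegrable (by fun_prop) _ _),
    ← intervalIntegral.integral_const_mul, ← intervalIntegral.integral_add]
  · exact intervalIntegral.integral_congr fun y _ => S.slice_energy hh y
  · exact (intervalIntegral.continuous_parametric_intervalIntegral_of_continuous'
      (by fun_prop) _ _).intervalIntegrable _ _
  · exact Continuous.intervalIntegrable (by fun_prop) _ _

/-- `robin_gap_bound` on each line `y = const`, where the energy is `∫ φ h` by `slice_energy`,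
integrated over `y`. -/
theorem gap {k κ : ℝ} (S : RobinSol β a b h φ φ₁) (hh : Continuous h) (hab : a ≤ b) (hcd : c ≤ d)
    (hf : RobinFreq β ((b - a) / 2) k κ) :
    κ ^ 2 * (∫ z in Ioo a b ×ˢ Ioo c d, φ z ^ 2) -
        (κ ^ 2 - k ^ 2) * ((∫ x in a..b, cosMode a b k x ^ 2)⁻¹ *
          ∫ y in c..d, (∫ x in a..b, φ (x, y) * cosMode a b k x) ^ 2) ≤
      ∫ z in Ioo a b ×ˢ Ioo c d, φ z * h z := by
  have c1 := S.contDiff.continuous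
  have c2 := S.contDiff'.continuous
  have i1 : Continuous fun y => ∫ x in a..b, φ (x, y) ^ 2 :=
    intervalIntegral.continuous_parametric_intervalIntegral_of_continuous' (by fun_prop) _ _
  have i2 : Continuous fun y => ∫ x in a..b, φ (x, y) * cosMode a b k x :=
    intervalIntegral.continuous_parametric_intervalIntegral_of_continuous' (by fun_prop) _ _
  have i3 : Continuous fun y => ∫ x in a..b, φ (x, y) * h (x, y) :=
    intervalIntegral.continuous_parametric_intervalIntegral_of_continuous' (by fun_prop) _ _
  rw [integral_rect' hab hcd (by fun_prop), integral_rect' hab hcd (by fun_prop),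
    ← intervalIntegral.integral_const_mul, ← intervalIntegral.integral_const_mul,
    ← intervalIntegral.integral_const_mul, ← intervalIntegral.integral_sub]
  · refine intervalIntegral.integral_mono_on hcd ?_ (i3.intervalIntegrable _ _) fun y _ => ?_
    · exact Continuous.intervalIntegrable (by fun_prop) _ _
    · rw [← S.slice_energy hh y]
      exact robin_gap_bound hf (fun x => S.hasDeriv x y) (by fun_prop)
  · exact Continuous.intervalIntegrable (by fun_prop) _ _
  · exact Continuous.intervalIntegrable (by fun_prop) _ _

theorem fderiv_apply (S : RobinSol β a b h φ φ₁) (z : ℝ × ℝ) :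
    fderiv ℝ φ₁ z (1, 0) = -h z := by
  have hd : HasFDerivAt φ₁ (fderiv ℝ φ₁ z) (z.1, z.2) :=
    ((S.contDiff'.differentiable one_ne_zero) z).hasFDerivAt
  have hg : HasDerivAt (fun x : ℝ => (x, z.2)) ((1 : ℝ), (0 : ℝ)) z.1 :=
    (hasDerivAt_id z.1).prodMk (hasDerivAt_const z.1 z.2)
  exact (hd.comp_hasDerivAt z.1 hg).unique (S.hasDeriv' z.1 z.2)

end RobinSol

/-! ### Lower bounds by duality -/

/-- Abstract dual lower bound for a quadratic form, from approximate solutions. -/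
theorem dual_lower_bound {H : Type*} [NormedAddCommGroup H] [InnerProductSpace ℝ H]
    (K : Submodule ℝ H) [K.HasOrthogonalProjection] {l m q : ℝ} (hl : 0 < l) (hlm : l ≤ m) (w : H)
    (hsol : ∀ v : H, ∀ ε > 0, ∃ h φ : H, ‖h - v‖ < ε ∧
      m * ‖φ‖ ^ 2 - (m - l) * ‖K.starProjection φ‖ ^ 2 ≤ ⟪φ, h⟫_ℝ ∧
      2 * ⟪w, h⟫_ℝ - ⟪φ, h⟫_ℝ ≤ q) :
    m * ‖w‖ ^ 2 - (m - l) * ‖K.starProjection w‖ ^ 2 ≤ q := by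
  -- The symmetric operator of the form on the left, bounded below by `l`. The data `h` are taken
  -- close to `T w`.
  set T : H → H := fun v => m • v - (m - l) • K.starProjection v with hT
  have hPP : ∀ u v : H, ⟪u, K.starProjection v⟫_ℝ = ⟪K.starProjection u, K.starProjection v⟫_ℝ :=
    fun u v => by
      rw [K.inner_starProjection_left_eq_right, K.starProjection_eq_self_iff.2
        (K.starProjection_apply_mem v)]
  have hTuv : ∀ u v : H, ⟪u, T v⟫_ℝ = l * ⟪u, v⟫_ℝ +
      (m - l) * ⟪u - K.starProjection u, v - K.starProjection v⟫_ℝ := fun u v => by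
    have h1 : ⟪K.starProjection u, v⟫_ℝ = ⟪u, K.starProjection v⟫_ℝ :=
      K.inner_starProjection_left_eq_right u v
    simp only [hT, inner_sub_left, inner_sub_right, real_inner_smul_right]
    rw [← hPP, h1]; ring
  have hBB : ∀ v : H, m * ‖v‖ ^ 2 - (m - l) * ‖K.starProjection v‖ ^ 2 = ⟪v, T v⟫_ℝ := fun v => by
    simp only [hT, inner_sub_right, real_inner_smul_right]
    rw [hPP, real_inner_self_eq_norm_sq, real_inner_self_eq_norm_sq]
  have hpos : ∀ v : H, l * ‖v‖ ^ 2 ≤ ⟪v, T v⟫_ℝ := fun v => by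
    rw [hTuv, real_inner_self_eq_norm_sq, real_inner_self_eq_norm_sq]
    have := mul_nonneg (sub_nonneg.2 hlm) (sq_nonneg ‖v - K.starProjection v‖)
    linarith
  have hsymm : ∀ u v : H, ⟪u, T v⟫_ℝ = ⟪v, T u⟫_ℝ := fun u v => by
    rw [hTuv, hTuv, real_inner_comm, real_inner_comm (v - K.starProjection v)]
  have hTsub : ∀ u v : H, T (u - v) = T u - T v := fun u v => by
    simp only [hT, map_sub, smul_sub]; abel
  rw [hBB]
  set C := (‖T w‖ + 1) / l with hC
  have key : ∀ ε ∈ Ioo (0 : ℝ) 1, ⟪w, T w⟫_ℝ ≤ q + (2 * ‖w‖ + 2 * C) * ε := by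
    rintro ε ⟨hε, hε1⟩
    obtain ⟨h, φ, hh, h1, h2⟩ := hsol (T w) ε hε
    rw [hBB] at h1
    have hφC : ‖φ‖ ≤ C := by
      have a1 : l * ‖φ‖ ^ 2 ≤ ‖φ‖ * ‖h‖ :=
        ((hpos φ).trans h1).trans (real_inner_le_norm _ _)
      have a2 : ‖h‖ ≤ ‖T w‖ + 1 := by
        have := norm_le_norm_add_norm_sub' h (T w)
        linarith
      rw [hC, le_div_iff₀ hl]
      rcases (norm_nonneg φ).eq_or_lt with h0 | h0
      · rw [← h0]; have := norm_nonneg (T w); linarith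
      · have : ‖φ‖ * (l * ‖φ‖) ≤ ‖φ‖ * ‖h‖ := by linarith
        have := le_of_mul_le_mul_left this h0
        linarith
    have b1 : ⟪φ, h⟫_ℝ ≤ ⟪φ, T w⟫_ℝ + C * ε := by
      have : ⟪φ, h - T w⟫_ℝ ≤ ‖φ‖ * ‖h - T w‖ := real_inner_le_norm _ _
      have e := mul_le_mul hφC hh.le (norm_nonneg _) ((norm_nonneg φ).trans hφC)
      rw [inner_sub_right] at this
      linarith
    -- Positivity of the form at `φ - w`. With `h1` and `b1` it gives `⟪φ, h⟫ ≤ ⟪w, T w⟫` up to a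
    -- multiple of `ε`, so `2⟪w, h⟫ - ⟪φ, h⟫` is at least about `⟪w, T w⟫`.
    have b2 : 2 * ⟪φ, T w⟫_ℝ ≤ ⟪φ, T φ⟫_ℝ + ⟪w, T w⟫_ℝ := by
      have := (mul_nonneg hl.le (sq_nonneg ‖φ - w‖)).trans (hpos (φ - w))
      rw [hTsub, inner_sub_right, inner_sub_left, inner_sub_left, hsymm w φ] at this
      linarith
    have b3 : ⟪w, T w⟫_ℝ - ‖w‖ * ε ≤ ⟪w, h⟫_ℝ := by
      have : ⟪w, T w - h⟫_ℝ ≤ ‖w‖ * ‖T w - h‖ := real_inner_le_norm _ _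
      have e := mul_le_mul_of_nonneg_left hh.le (norm_nonneg w)
      rw [norm_sub_rev] at e
      rw [inner_sub_right] at this
      linarith
    linarith
  have hr : Tendsto (fun ε : ℝ => q + (2 * ‖w‖ + 2 * C) * ε) (nhdsWithin 0 (Ioi 0)) (nhds q) := by
    have : Continuous (fun ε : ℝ => q + (2 * ‖w‖ + 2 * C) * ε) := by fun_prop
    simpa using (this.tendsto 0).mono_left nhdsWithin_le_nhds
  exact ge_of_tendsto hr (Filter.eventually_of_mem (Ioo_mem_nhdsGT one_pos) key)

/-! ### Projections onto functions with one factor prescribed -/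

/-- `q ↦ p ⊗ q`. -/
def tensorFst (p : C(ℝ, ℝ)) : C(ℝ, ℝ) →ₗ[ℝ] C(ℝ × ℝ, ℝ) where
  toFun q := ⟨fun z => p z.1 * q z.2, by fun_prop⟩
  map_add' q q' := by ext z; simp [mul_add]
  map_smul' r q := by ext z; simp [mul_left_comm]

/-- `p ↦ p ⊗ q`. -/
def tensorSnd (q : C(ℝ, ℝ)) : C(ℝ, ℝ) →ₗ[ℝ] C(ℝ × ℝ, ℝ) where
  toFun p := ⟨fun z => p z.1 * q z.2, by fun_prop⟩
  map_add' p p' := by ext z; simp [add_mul]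
  map_smul' r p := by ext z; simp [mul_assoc]

@[simp] theorem tensorFst_apply (p q : C(ℝ, ℝ)) (z : ℝ × ℝ) : tensorFst p q z = p z.1 * q z.2 := rfl
@[simp] theorem tensorSnd_apply (p q : C(ℝ, ℝ)) (z : ℝ × ℝ) : tensorSnd q p z = p z.1 * q z.2 := rfl

/-- `y ↦ ∫ F(x, y) p(x) dx`. -/
def avgFst (a b : ℝ) (p : C(ℝ, ℝ)) (F : C(ℝ × ℝ, ℝ)) : C(ℝ, ℝ) :=
  ⟨fun y => ∫ x in a..b, F (x, y) * p x,
    intervalIntegral.continuous_parametric_intervalIntegral_of_continuous' (by fun_prop) _ _⟩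

/-- `x ↦ ∫ F(x, y) q(y) dy`. -/
def avgSnd (c d : ℝ) (q : C(ℝ, ℝ)) (F : C(ℝ × ℝ, ℝ)) : C(ℝ, ℝ) :=
  ⟨fun x => ∫ y in c..d, F (x, y) * q y,
    intervalIntegral.continuous_parametric_intervalIntegral_of_continuous' (by fun_prop) _ _⟩

namespace Rectangle

variable (R : Rectangle)

/-- The closure of `{p ⊗ q}` for fixed `p`. -/
def fstSpace (p : C(ℝ, ℝ)) : Submodule ℝ (L2On R.domain) :=
  (LinearMap.range ((ofCont R.isBounded_domain).comp (tensorFst p))).topologicalClosure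

/-- The closure of `{p ⊗ q}` for fixed `q`. -/
def sndSpace (q : C(ℝ, ℝ)) : Submodule ℝ (L2On R.domain) :=
  (LinearMap.range ((ofCont R.isBounded_domain).comp (tensorSnd q))).topologicalClosure

instance (p : C(ℝ, ℝ)) : (R.fstSpace p).HasOrthogonalProjection := by
  unfold fstSpace; infer_instance

instance (q : C(ℝ, ℝ)) : (R.sndSpace q).HasOrthogonalProjection := by
  unfold sndSpace; infer_instance

theorem integral_domain {F : ℝ × ℝ → ℝ} (hF : Continuous F) :
    ∫ z in R.domain, F z = ∫ x in R.a..R.b, ∫ y in R.c..R.d, F (x, y) :=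
  integral_rect R.hab.le R.hcd.le hF

theorem integral_domain' {F : ℝ × ℝ → ℝ} (hF : Continuous F) :
    ∫ z in R.domain, F z = ∫ y in R.c..R.d, ∫ x in R.a..R.b, F (x, y) :=
  integral_rect' R.hab.le R.hcd.le hF

theorem fstSpace_proj {p : C(ℝ, ℝ)} {N : ℝ} (hN : N ≠ 0) (hp : ∫ x in R.a..R.b, p x ^ 2 = N)
    (F : C(ℝ × ℝ, ℝ)) :
    (R.fstSpace p).starProjection (ofCont R.isBounded_domain F) =
      ofCont R.isBounded_domain (tensorFst p (N⁻¹ • avgFst R.a R.b p F)) := by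
  refine Submodule.eq_starProjection_of_mem_orthogonal ?_ ?_
  · exact Submodule.le_topologicalClosure _ ⟨_, rfl⟩
  · rw [fstSpace, Submodule.orthogonal_closure, Submodule.mem_orthogonal]
    rintro _ ⟨q, rfl⟩
    rw [← map_sub, LinearMap.comp_apply, inner_ofCont_ofCont, R.integral_domain' (by fun_prop)]
    rw [show (fun y => ∫ x in R.a..R.b, tensorFst p q (x, y) *
        (F - tensorFst p (N⁻¹ • avgFst R.a R.b p F)) (x, y)) = fun _ => 0 from ?_]
    · simp
    funext y
    have e : ∀ x, tensorFst p q (x, y) * (F - tensorFst p (N⁻¹ • avgFst R.a R.b p F)) (x, y) =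
        q y * (F (x, y) * p x) - q y * (N⁻¹ * avgFst R.a R.b p F y) * p x ^ 2 := fun x => by
      simp; ring
    simp only [e]
    rw [intervalIntegral.integral_sub (Continuous.intervalIntegrable (by fun_prop) _ _)
      (Continuous.intervalIntegrable (by fun_prop) _ _), intervalIntegral.integral_const_mul,
      intervalIntegral.integral_const_mul, hp]
    rw [show (∫ x in R.a..R.b, F (x, y) * p x) = avgFst R.a R.b p F y from rfl]
    field_simp
    ring

theorem sndSpace_proj {q : C(ℝ, ℝ)} {N : ℝ} (hN : N ≠ 0) (hq : ∫ y in R.c..R.d, q y ^ 2 = N)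
    (F : C(ℝ × ℝ, ℝ)) :
    (R.sndSpace q).starProjection (ofCont R.isBounded_domain F) =
      ofCont R.isBounded_domain (tensorSnd q (N⁻¹ • avgSnd R.c R.d q F)) := by
  refine Submodule.eq_starProjection_of_mem_orthogonal ?_ ?_
  · exact Submodule.le_topologicalClosure _ ⟨_, rfl⟩
  · rw [sndSpace, Submodule.orthogonal_closure, Submodule.mem_orthogonal]
    rintro _ ⟨p, rfl⟩
    rw [← map_sub, LinearMap.comp_apply, inner_ofCont_ofCont, R.integral_domain (by fun_prop)]
    rw [show (fun x => ∫ y in R.c..R.d, tensorSnd q p (x, y) *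
        (F - tensorSnd q (N⁻¹ • avgSnd R.c R.d q F)) (x, y)) = fun _ => 0 from ?_]
    · simp
    funext x
    have e : ∀ y, tensorSnd q p (x, y) * (F - tensorSnd q (N⁻¹ • avgSnd R.c R.d q F)) (x, y) =
        p x * (F (x, y) * q y) - p x * (N⁻¹ * avgSnd R.c R.d q F x) * q y ^ 2 := fun y => by
      simp; ring
    simp only [e]
    rw [intervalIntegral.integral_sub (Continuous.intervalIntegrable (by fun_prop) _ _)
      (Continuous.intervalIntegrable (by fun_prop) _ _), intervalIntegral.integral_const_mul,
      intervalIntegral.integral_const_mul, hq]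
    rw [show (∫ y in R.c..R.d, F (x, y) * q y) = avgSnd R.c R.d q F x from rfl]
    field_simp
    ring

theorem norm_sq_starProjection {H : Type*} [NormedAddCommGroup H] [InnerProductSpace ℝ H]
    (K : Submodule ℝ H) [K.HasOrthogonalProjection] (v : H) :
    ‖K.starProjection v‖ ^ 2 = ⟪v, K.starProjection v⟫_ℝ := by
  rw [← real_inner_self_eq_norm_sq, K.inner_starProjection_left_eq_right,
    K.starProjection_eq_self_iff.2 (K.starProjection_apply_mem v)]

theorem norm_sq_fstSpace_proj {p : C(ℝ, ℝ)} {N : ℝ} (hN : N ≠ 0)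
    (hp : ∫ x in R.a..R.b, p x ^ 2 = N) (F : C(ℝ × ℝ, ℝ)) :
    ‖(R.fstSpace p).starProjection (ofCont R.isBounded_domain F)‖ ^ 2 =
      N⁻¹ * ∫ y in R.c..R.d, (∫ x in R.a..R.b, F (x, y) * p x) ^ 2 := by
  rw [norm_sq_starProjection, R.fstSpace_proj hN hp, inner_ofCont_ofCont,
    R.integral_domain' (by fun_prop), ← intervalIntegral.integral_const_mul]
  refine intervalIntegral.integral_congr fun y _ => ?_
  have e : ∀ x, F (x, y) * tensorFst p (N⁻¹ • avgFst R.a R.b p F) (x, y) =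
      (N⁻¹ * avgFst R.a R.b p F y) * (F (x, y) * p x) := fun x => by
    simp; ring
  simp only [e]
  rw [intervalIntegral.integral_const_mul,
    show (∫ x in R.a..R.b, F (x, y) * p x) = avgFst R.a R.b p F y from rfl]
  ring

theorem norm_sq_sndSpace_proj {q : C(ℝ, ℝ)} {N : ℝ} (hN : N ≠ 0)
    (hq : ∫ y in R.c..R.d, q y ^ 2 = N) (F : C(ℝ × ℝ, ℝ)) :
    ‖(R.sndSpace q).starProjection (ofCont R.isBounded_domain F)‖ ^ 2 =
      N⁻¹ * ∫ x in R.a..R.b, (∫ y in R.c..R.d, F (x, y) * q y) ^ 2 := by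
  rw [norm_sq_starProjection, R.sndSpace_proj hN hq, inner_ofCont_ofCont,
    R.integral_domain (by fun_prop), ← intervalIntegral.integral_const_mul]
  refine intervalIntegral.integral_congr fun x _ => ?_
  have e : ∀ y, F (x, y) * tensorSnd q (N⁻¹ • avgSnd R.c R.d q F) (x, y) =
      (N⁻¹ * avgSnd R.c R.d q F x) * (F (x, y) * q y) := fun y => by
    simp; ring
  simp only [e]
  rw [intervalIntegral.integral_const_mul,
    show (∫ y in R.c..R.d, F (x, y) * q y) = avgSnd R.c R.d q F x from rfl]
  ring

/-- The two projections compose to the projection on `p ⊗ q`. -/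
theorem fstSpace_proj_sndSpace_proj {p q : C(ℝ, ℝ)} {N M : ℝ} (hN : N ≠ 0) (hM : M ≠ 0)
    (hp : ∫ x in R.a..R.b, p x ^ 2 = N) (hq : ∫ y in R.c..R.d, q y ^ 2 = M) (w : L2On R.domain) :
    (R.fstSpace p).starProjection ((R.sndSpace q).starProjection w) =
      (N⁻¹ * M⁻¹ * ⟪w, ofCont R.isBounded_domain (tensorFst p q)⟫_ℝ) •
        ofCont R.isBounded_domain (tensorFst p q) := by
  refine (denseRange_ofCont R.isBounded_domain).induction_on w ?_ ?_
  · exact isClosed_eq (by fun_prop) (by fun_prop)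
  · intro F
    rw [R.sndSpace_proj hM hq, R.fstSpace_proj hN hp, inner_ofCont_ofCont,
      R.integral_domain (by fun_prop), ← map_smul]
    congr 1
    ext z
    have e1 : avgFst R.a R.b p (tensorSnd q (M⁻¹ • avgSnd R.c R.d q F)) z.2 =
        M⁻¹ * q z.2 * ∫ x in R.a..R.b, ∫ y in R.c..R.d, F (x, y) * tensorFst p q (x, y) := by
      rw [← intervalIntegral.integral_const_mul]
      refine intervalIntegral.integral_congr fun x _ => ?_
      have e : ∀ y, F (x, y) * tensorFst p q (x, y) = p x * (F (x, y) * q y) := fun y => by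
        simp; ring
      simp only [e]
      rw [intervalIntegral.integral_const_mul]
      simp [avgSnd]
      ring
    rw [tensorFst_apply, ContinuousMap.smul_apply, e1]
    simp
    ring

/-- The composite of the two projections is the projection on `p ⊗ q`, which kills `w`. Hence the
two projections of `w` are orthogonal to each other, and the claim is Bessel's inequality. -/
theorem norm_sq_proj_add_le {p q : C(ℝ, ℝ)} {N M : ℝ} (hN : N ≠ 0) (hM : M ≠ 0)
    (hp : ∫ x in R.a..R.b, p x ^ 2 = N) (hq : ∫ y in R.c..R.d, q y ^ 2 = M) {w : L2On R.domain}
    (hw : ⟪w, ofCont R.isBounded_domain (tensorFst p q)⟫_ℝ = 0) :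
    ‖(R.fstSpace p).starProjection w‖ ^ 2 + ‖(R.sndSpace q).starProjection w‖ ^ 2 ≤ ‖w‖ ^ 2 := by
  have h := R.fstSpace_proj_sndSpace_proj hN hM hp hq w
  rw [hw, mul_zero, zero_smul] at h
  have h1 := norm_sq_starProjection (R.fstSpace p) w
  have h2 := norm_sq_starProjection (R.sndSpace q) w
  have h3 : ⟪(R.fstSpace p).starProjection w, (R.sndSpace q).starProjection w⟫_ℝ = 0 := by
    rw [Submodule.inner_starProjection_left_eq_right, h, inner_zero_right]
  have h4 := sq_nonneg ‖w - (R.fstSpace p).starProjection w - (R.sndSpace q).starProjection w‖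
  rw [norm_sub_sq_real, norm_sub_sq_real, inner_sub_left, ← h1, ← h2, h3] at h4
  linarith

/-- The even mode in the first variable. -/
def cosFst (k : ℝ) : C(ℝ, ℝ) := ⟨cosMode R.a R.b k, by fun_prop⟩

/-- The even mode in the second variable. -/
def cosSnd (l : ℝ) : C(ℝ, ℝ) := ⟨cosMode R.c R.d l, by fun_prop⟩

end Rectangle

/-! ### Lower bounds for the two directional halves of the Robin form -/

theorem prodSpan_swap {G : C(ℝ × ℝ, ℝ)} (hG : G ∈ prodSpan) :
    G.comp ⟨Prod.swap, continuous_swap⟩ ∈ prodSpan := by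
  induction hG using Submodule.span_induction with
  | mem F hF =>
    obtain ⟨p, q, hp, hq, e⟩ := hF
    exact Submodule.subset_span ⟨q, p, hq, hp, fun z => by simp [e, mul_comm]⟩
  | zero => exact prodSpan.zero_mem
  | add F G _ _ hF hG => exact prodSpan.add_mem hF hG
  | smul r F _ hF => exact prodSpan.smul_mem r hF

theorem two_inner_sub_le {H : Type*} [NormedAddCommGroup H] [InnerProductSpace ℝ H] (u v : H) :
    2 * ⟪u, v⟫_ℝ - ‖v‖ ^ 2 ≤ ‖u‖ ^ 2 := by
  have := sq_nonneg ‖u - v‖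
  rw [norm_sub_sq_real] at this
  linarith

namespace Rectangle

variable {R : Rectangle}

/-- Gauss-Green with test function `φ₁ = ∂ₓφ` expresses `⟪w, h⟫` as the form paired between `w` and
`φ`. The bound `2⟪u, v⟫ - ‖v‖² ≤ ‖u‖²`, applied to the gradient and to both traces, then gives `2⟪w,
h⟫ - ⟪φ, h⟫ ≤ q`, because the energy of `φ` is `⟪φ, h⟫`. -/
theorem fst_form_bound {β k κ : ℝ} (hβ : 0 < β) (hf : RobinFreq β ((R.b - R.a) / 2) k κ)
    {w : R.Tuple} (hw : w ∈ R.H1) :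
    κ ^ 2 * ‖val w‖ ^ 2 -
        (κ ^ 2 - k ^ 2) * ‖(R.fstSpace (R.cosFst k)).starProjection (val w)‖ ^ 2 ≤
      ‖dx w‖ ^ 2 + β * (‖left w‖ ^ 2 + ‖right w‖ ^ 2) := by
  refine dual_lower_bound _ (pow_pos hf.k_pos 2) hf.sq_lt.le _ fun v ε hε => ?_
  obtain ⟨G, hG, hGv⟩ := exists_prodSpan_norm_lt R.isBounded_domain R.measurableSet_domain v hε
  obtain ⟨φ, φ₁, S⟩ := exists_robinSol hβ R.hab hG
  have c1 := S.contDiff.continuous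
  have c2 := S.contDiff'.continuous
  refine ⟨ofCont R.isBounded_domain G, ofCont R.isBounded_domain ⟨φ, c1⟩, hGv, ?_, ?_⟩
  · have hN := integral_cosMode_sq_pos hf
    rw [norm_sq_ofCont, R.norm_sq_fstSpace_proj hN.ne' rfl, inner_ofCont_ofCont]
    exact S.gap G.continuous R.hab.le R.hcd.le hf
  · have ht := (hw φ₁ S.contDiff').1
    simp only [S.fderiv_apply, S.left, S.right, mul_neg, integral_neg, mul_left_comm _ β,
      integral_const_mul] at ht
    have he := S.energy G.continuous R.hab.le R.hcd.le
    have h1 := two_inner_sub_le (dx w) (ofCont R.isBounded_domain ⟨φ₁, c2⟩)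
    have h2 := two_inner_sub_le (left w)
      (ofCont (Metric.isBounded_Ioo R.c R.d) ⟨fun y => φ (R.a, y), by fun_prop⟩)
    have h3 := two_inner_sub_le (right w)
      (ofCont (Metric.isBounded_Ioo R.c R.d) ⟨fun y => φ (R.b, y), by fun_prop⟩)
    rw [inner_ofCont, norm_sq_ofCont] at h1 h2 h3
    rw [inner_ofCont, inner_ofCont_ofCont]
    simp only [ContinuousMap.coe_mk] at h1 h2 h3 ⊢
    have h4 := mul_le_mul_of_nonneg_left (add_le_add h2 h3) hβ.le
    change (∫ z in R.domain, φ₁ z ^ 2) + _ = ∫ z in R.domain, φ z * G z at he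
    linarith

/-- The argument of `fst_form_bound` with the coordinates exchanged: the Robin problem is solved for
the swapped data. -/
theorem snd_form_bound {β k κ : ℝ} (hβ : 0 < β) (hf : RobinFreq β ((R.d - R.c) / 2) k κ)
    {w : R.Tuple} (hw : w ∈ R.H1) :
    κ ^ 2 * ‖val w‖ ^ 2 -
        (κ ^ 2 - k ^ 2) * ‖(R.sndSpace (R.cosSnd k)).starProjection (val w)‖ ^ 2 ≤
      ‖dy w‖ ^ 2 + β * (‖bottom w‖ ^ 2 + ‖top w‖ ^ 2) := by
  refine dual_lower_bound _ (pow_pos hf.k_pos 2) hf.sq_lt.le _ fun v ε hε => ?_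
  obtain ⟨G, hG, hGv⟩ := exists_prodSpan_norm_lt R.isBounded_domain R.measurableSet_domain v hε
  obtain ⟨φ, φ₁, S⟩ := exists_robinSol hβ R.hcd (prodSpan_swap hG)
  have c1 := S.contDiff.continuous
  have c2 := S.contDiff'.continuous
  have hGs : ∀ z : ℝ × ℝ, G.comp ⟨Prod.swap, continuous_swap⟩ z = G z.swap := fun _ => rfl
  have hGc : Continuous (G.comp ⟨Prod.swap, continuous_swap⟩) := ContinuousMap.continuous _
  refine ⟨ofCont R.isBounded_domain G,
    ofCont R.isBounded_domain ⟨fun z => φ z.swap, c1.comp continuous_swap⟩, hGv, ?_, ?_⟩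
  · have hN := integral_cosMode_sq_pos hf
    rw [norm_sq_ofCont, R.norm_sq_sndSpace_proj hN.ne' rfl, inner_ofCont_ofCont]
    have := S.gap hGc R.hcd.le R.hab.le hf
    rw [← integral_rect_swap, ← integral_rect_swap (fun z => φ z * _)] at this
    exact this
  · have hcd1 : ContDiff ℝ 1 (fun z : ℝ × ℝ => φ₁ z.swap) :=
      S.contDiff'.comp (contDiff_snd.prodMk contDiff_fst)
    have hfd : ∀ z : ℝ × ℝ, fderiv ℝ (fun z : ℝ × ℝ => φ₁ z.swap) z (0, 1) = -G z := by
      intro z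
      have hd : HasFDerivAt (fun z : ℝ × ℝ => φ₁ z.swap)
          (fderiv ℝ (fun z : ℝ × ℝ => φ₁ z.swap) z) (z.1, z.2) :=
        ((hcd1.differentiable one_ne_zero) z).hasFDerivAt
      have hg : HasDerivAt (fun y : ℝ => (z.1, y)) ((0 : ℝ), (1 : ℝ)) z.2 :=
        (hasDerivAt_const z.2 z.1).prodMk (hasDerivAt_id z.2)
      exact (hd.comp_hasDerivAt z.2 hg).unique (S.hasDeriv' z.2 z.1)
    have ht := (hw _ hcd1).2
    simp only [hfd, Prod.swap_prod_mk, S.left, S.right, mul_neg, integral_neg, mul_left_comm _ β,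
      integral_const_mul] at ht
    have he := S.energy hGc R.hcd.le R.hab.le
    rw [← integral_rect_swap, ← integral_rect_swap (fun z => φ z * _)] at he
    have h1 := two_inner_sub_le (dy w)
      (ofCont R.isBounded_domain ⟨fun z => φ₁ z.swap, c2.comp continuous_swap⟩)
    have h2 := two_inner_sub_le (bottom w)
      (ofCont (Metric.isBounded_Ioo R.a R.b) ⟨fun y => φ (R.c, y), by fun_prop⟩)
    have h3 := two_inner_sub_le (top w)
      (ofCont (Metric.isBounded_Ioo R.a R.b) ⟨fun y => φ (R.d, y), by fun_prop⟩)
    rw [inner_ofCont, norm_sq_ofCont] at h1 h2 h3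
    rw [inner_ofCont, inner_ofCont_ofCont]
    simp only [ContinuousMap.coe_mk] at h1 h2 h3 ⊢
    have h4 := mul_le_mul_of_nonneg_left (add_le_add h2 h3) hβ.le
    change (∫ z in R.domain, φ₁ z.swap ^ 2) + _ = ∫ z in R.domain, φ z.swap * G z at he
    linarith

end Rectangle

/-! ### The space `H1`: uniqueness of gradient and traces, product eigenfunctions -/

theorem eq_zero_of_inner_contDiff {E : Type} [NormedAddCommGroup E] [NormedSpace ℝ E]
    [FiniteDimensional ℝ E] [MeasureSpace E] [BorelSpace E]
    [IsFiniteMeasureOnCompacts (volume : Measure E)] {s : Set E} (hs : IsOpen s)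
    (hb : Bornology.IsBounded s) (u : L2On s)
    (h : ∀ g : E → ℝ, ContDiff ℝ 1 g → (∀ z ∉ s, g z = 0) → ∫ z in s, u z * g z = 0) : u = 0 := by
  have : ProperSpace E := FiniteDimensional.proper ℝ E
  have : IsFiniteMeasure ((volume : Measure E).restrict s) :=
    ⟨by rw [Measure.restrict_apply_univ]; exact hb.measure_lt_top⟩
  have hi : Integrable u ((volume : Measure E).restrict s) := (Lp.memLp u).integrable (by norm_num)
  have key := hs.ae_eq_zero_of_integral_contDiff_smul_eq_zero
    (μ := (volume : Measure E).restrict s) (hi.locallyIntegrable.locallyIntegrableOn s)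
    fun g hg _ hgs => by
      have := h g (hg.of_le (by exact_mod_cast le_top)) fun z hz =>
        image_eq_zero_of_notMem_tsupport fun h' => hz (hgs h')
      simpa only [smul_eq_mul, mul_comm] using this
  refine Lp.ext ?_
  filter_upwards [key, ae_restrict_mem hs.measurableSet, Lp.coeFn_zero ℝ 2 (volume.restrict s)]
    with z h1 h2 h3
  rw [h1 h2, h3]; rfl

/-- A Robin eigenfunction on `[a, b]` with eigenvalue `μ`, and its derivative. -/
structure RobinMode (β a b μ : ℝ) (p p' : C(ℝ, ℝ)) : Prop where
  hasDeriv : ∀ x, HasDerivAt p (p' x) x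
  hasDeriv' : ∀ x, HasDerivAt p' (-(μ * p x)) x
  left : p' a = β * p a
  right : p' b = -(β * p b)

namespace RobinMode

variable {β a b μ : ℝ} {p p' : C(ℝ, ℝ)}

theorem contDiff (h : RobinMode β a b μ p p') : ContDiff ℝ 1 p := by
  rw [contDiff_one_iff_deriv]
  refine ⟨fun x => (h.hasDeriv x).differentiableAt, ?_⟩
  rw [show deriv p = p' from funext fun x => (h.hasDeriv x).deriv]
  exact p'.continuous

theorem contDiff' (h : RobinMode β a b μ p p') : ContDiff ℝ 1 p' := by
  rw [contDiff_one_iff_deriv]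
  refine ⟨fun x => (h.hasDeriv' x).differentiableAt, ?_⟩
  rw [show deriv p' = fun x => -(μ * p x) from funext fun x => (h.hasDeriv' x).deriv]
  exact (continuous_const.mul p.continuous).neg

end RobinMode

def evenMode (a b k : ℝ) : C(ℝ, ℝ) := ⟨cosMode a b k, by fun_prop⟩
def evenMode' (a b k : ℝ) : C(ℝ, ℝ) := ⟨fun x => -k * sinMode a b k x, by fun_prop⟩
def oddMode (a b k : ℝ) : C(ℝ, ℝ) := ⟨sinMode a b k, by fun_prop⟩
def oddMode' (a b k : ℝ) : C(ℝ, ℝ) := ⟨fun x => k * cosMode a b k x, by fun_prop⟩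

theorem robinMode_even {β a b k κ : ℝ} (h : RobinFreq β ((b - a) / 2) k κ) :
    RobinMode β a b (k ^ 2) (evenMode a b k) (evenMode' a b k) where
  hasDeriv x := hasDerivAt_cosMode a b k x
  hasDeriv' x := ((hasDerivAt_sinMode a b k x).const_mul (-k)).congr_deriv (by
    simp [evenMode]; ring)
  left := by
    simp only [evenMode, evenMode', ContinuousMap.coe_mk, cosMode_left, sinMode_left]
    linarith [h.k_eq]
  right := by
    simp only [evenMode, evenMode', ContinuousMap.coe_mk, cosMode_right, sinMode_right]
    linarith [h.k_eq]

theorem robinMode_odd {β a b k κ : ℝ} (h : RobinFreq β ((b - a) / 2) k κ) :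
    RobinMode β a b (κ ^ 2) (oddMode a b κ) (oddMode' a b κ) where
  hasDeriv x := hasDerivAt_sinMode a b κ x
  hasDeriv' x := ((hasDerivAt_cosMode a b κ x).const_mul κ).congr_deriv (by
    simp [oddMode]; ring)
  left := by
    simp only [oddMode, oddMode', ContinuousMap.coe_mk, cosMode_left, sinMode_left]
    linarith [h.κ_eq]
  right := by
    simp only [oddMode, oddMode', ContinuousMap.coe_mk, cosMode_right, sinMode_right]
    linarith [h.κ_eq]

theorem integral_oddMode_sq_pos {a b β k κ : ℝ} (h : RobinFreq β ((b - a) / 2) k κ) :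
    0 < ∫ x in a..b, oddMode a b κ x ^ 2 := by
  have hab : a < b := by linarith [h.t_pos]
  refine intervalIntegral.integral_pos hab (by fun_prop) (fun x _ => sq_nonneg _)
    ⟨b, right_mem_Icc.2 hab.le, ?_⟩
  simp only [oddMode, ContinuousMap.coe_mk, sinMode_right]
  exact pow_pos (Real.sin_pos_of_pos_of_lt_pi (by linarith [h.lt_κ, Real.pi_pos]) h.κ_lt) 2

theorem setIntegral_ofCont_mul {X : Type} [PseudoMetricSpace X] [ProperSpace X] [MeasureSpace X]
    [BorelSpace X] [IsFiniteMeasureOnCompacts (volume : Measure X)] {s : Set X}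
    (hs : Bornology.IsBounded s) (F : C(X, ℝ)) (g : X → ℝ) :
    ∫ z in s, ofCont hs F z * g z = ∫ z in s, F z * g z := by
  refine integral_congr_ae ?_
  filter_upwards [coeFn_ofCont hs F] with z hz
  rw [hz]

theorem fderiv_apply_one_zero {φ : ℝ × ℝ → ℝ} (hφ : ContDiff ℝ 1 φ) (x y : ℝ) :
    HasDerivAt (fun x => φ (x, y)) (fderiv ℝ φ (x, y) (1, 0)) x := by
  have hd : HasFDerivAt φ (fderiv ℝ φ (x, y)) (x, y) :=
    ((hφ.differentiable one_ne_zero) _).hasFDerivAt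
  exact hd.comp_hasDerivAt x ((hasDerivAt_id x).prodMk (hasDerivAt_const x y))

theorem fderiv_apply_zero_one {φ : ℝ × ℝ → ℝ} (hφ : ContDiff ℝ 1 φ) (x y : ℝ) :
    HasDerivAt (fun y => φ (x, y)) (fderiv ℝ φ (x, y) (0, 1)) y := by
  have hd : HasFDerivAt φ (fderiv ℝ φ (x, y)) (x, y) :=
    ((hφ.differentiable one_ne_zero) _).hasFDerivAt
  exact hd.comp_hasDerivAt y ((hasDerivAt_const y x).prodMk (hasDerivAt_id y))

theorem continuous_fderiv_apply_const {φ : ℝ × ℝ → ℝ} (hφ : ContDiff ℝ 1 φ) (v : ℝ × ℝ) :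
    Continuous fun z => fderiv ℝ φ z v :=
  (hφ.continuous_fderiv one_ne_zero).clm_apply continuous_const

namespace Rectangle

variable {R : Rectangle}

theorem isOpen_domain (R : Rectangle) : IsOpen R.domain := isOpen_Ioo.prod isOpen_Ioo

/-- The function component determines a member of `H¹`. -/
theorem eq_zero_of_val_eq_zero {w : R.Tuple} (hw : w ∈ R.H1) (h : val w = 0) : w = 0 := by
  have hv : ∀ g : ℝ × ℝ → ℝ, ∫ z in R.domain, val w z * g z = 0 := fun g => by
    rw [h]
    refine integral_eq_zero_of_ae ?_
    filter_upwards [Lp.coeFn_zero ℝ 2 ((volume : Measure (ℝ × ℝ)).restrict R.domain)] with z hz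
    rw [hz, Pi.zero_apply, zero_mul]
  have hx : dx w = 0 := by
    refine eq_zero_of_inner_contDiff R.isOpen_domain R.isBounded_domain _ fun g hg h0 => ?_
    have e := (hw g hg).1
    have e1 : ∀ y, g (R.a, y) = 0 := fun y => h0 _ fun hz => lt_irrefl _ hz.1.1
    have e2 : ∀ y, g (R.b, y) = 0 := fun y => h0 _ fun hz => lt_irrefl _ hz.1.2
    rw [hv] at e
    simpa only [e1, e2, mul_zero, integral_zero, sub_self, zero_add] using e
  have hy : dy w = 0 := by
    refine eq_zero_of_inner_contDiff R.isOpen_domain R.isBounded_domain _ fun g hg h0 => ?_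
    have e := (hw g hg).2
    have e1 : ∀ x, g (x, R.c) = 0 := fun x => h0 _ fun hz => lt_irrefl _ hz.2.1
    have e2 : ∀ x, g (x, R.d) = 0 := fun x => h0 _ fun hz => lt_irrefl _ hz.2.2
    rw [hv] at e
    simpa only [e1, e2, mul_zero, integral_zero, sub_self, zero_add] using e
  have hxi : ∀ g : ℝ × ℝ → ℝ, ∫ z in R.domain, dx w z * g z = 0 := fun g => by
    -- Both components are zero, so `hv` is reused by writing the zero as `val w`.
    rw [hx, ← h]; exact hv g
  have hyi : ∀ g : ℝ × ℝ → ℝ, ∫ z in R.domain, dy w z * g z = 0 := fun g => by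
    rw [hy, ← h]; exact hv g
  have hab := sub_ne_zero.2 R.hab.ne
  have hcd := sub_ne_zero.2 R.hcd.ne
  have hab' := sub_ne_zero.2 R.hab.ne'
  have hcd' := sub_ne_zero.2 R.hcd.ne'
  have hl : left w = 0 := by
    refine eq_zero_of_inner_contDiff isOpen_Ioo (Metric.isBounded_Ioo _ _) _ fun g hg _ => ?_
    -- The linear factor vanishes on the opposite side and is a nonzero constant on this one, so
    -- only the trace in question survives.
    have := (hw (fun z => (z.1 - R.b) * g z.2) (by fun_prop)).1
    simp only [hv, hxi, sub_self, zero_mul, mul_zero, integral_zero, mul_left_comm _ (R.a - R.b),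
      integral_const_mul] at this
    simpa [hab] using this
  have hr : right w = 0 := by
    refine eq_zero_of_inner_contDiff isOpen_Ioo (Metric.isBounded_Ioo _ _) _ fun g hg _ => ?_
    have := (hw (fun z => (z.1 - R.a) * g z.2) (by fun_prop)).1
    simp only [hv, hxi, sub_self, zero_mul, mul_zero, integral_zero, mul_left_comm _ (R.b - R.a),
      integral_const_mul] at this
    simpa [hab'] using this
  have hb : bottom w = 0 := by
    refine eq_zero_of_inner_contDiff isOpen_Ioo (Metric.isBounded_Ioo _ _) _ fun g hg _ => ?_
    have := (hw (fun z => (z.2 - R.d) * g z.1) (by fun_prop)).2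
    simp only [hv, hyi, sub_self, zero_mul, mul_zero, integral_zero, mul_left_comm _ (R.c - R.d),
      integral_const_mul] at this
    simpa [hcd] using this
  have ht : top w = 0 := by
    refine eq_zero_of_inner_contDiff isOpen_Ioo (Metric.isBounded_Ioo _ _) _ fun g hg _ => ?_
    have := (hw (fun z => (z.2 - R.c) * g z.1) (by fun_prop)).2
    simp only [hv, hyi, sub_self, zero_mul, mul_zero, integral_zero, mul_left_comm _ (R.d - R.c),
      integral_const_mul] at this
    simpa [hcd'] using this
  exact Prod.ext h (Prod.ext (Prod.ext hx hy) (Prod.ext (Prod.ext hl hr) (Prod.ext hb ht)))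

/-- The symmetric bilinear form of `robinForm`. -/
def robinInner (β : ℝ) (w v : R.Tuple) : ℝ :=
  ⟪dx w, dx v⟫_ℝ + ⟪dy w, dy v⟫_ℝ + β * (⟪left w, left v⟫_ℝ + ⟪right w, right v⟫_ℝ +
    ⟪bottom w, bottom v⟫_ℝ + ⟪top w, top v⟫_ℝ)

theorem robinInner_add_smul (β : ℝ) (w u v : R.Tuple) (r s : ℝ) :
    robinInner β w (r • u + s • v) = r * robinInner β w u + s * robinInner β w v := by
  simp only [robinInner, dx, dy, left, right, bottom, top, Prod.snd_add, Prod.fst_add,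
    Prod.smul_fst, Prod.smul_snd, inner_add_right, real_inner_smul_right]
  ring

theorem robinInner_comm (β : ℝ) (w v : R.Tuple) : robinInner β w v = robinInner β v w := by
  simp only [robinInner, real_inner_comm]

theorem robinForm_eq_norm (β : ℝ) (w : R.Tuple) :
    R.robinForm β w = ‖dx w‖ ^ 2 + ‖dy w‖ ^ 2 +
      β * (‖left w‖ ^ 2 + ‖right w‖ ^ 2 + ‖bottom w‖ ^ 2 + ‖top w‖ ^ 2) := by
  rw [robinForm, integral_add (Lp.memLp _).integrable_sq (Lp.memLp _).integrable_sq]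
  simp only [norm_sq_eq_integral]

theorem robinForm_eq_inner (β : ℝ) (w : R.Tuple) : R.robinForm β w = robinInner β w w := by
  rw [robinForm_eq_norm, robinInner]
  simp only [real_inner_self_eq_norm_sq]

theorem rayleigh_eq (β : ℝ) (w : R.Tuple) :
    R.rayleigh β w = R.robinForm β w / ‖val w‖ ^ 2 := by
  rw [rayleigh, norm_sq_eq_integral]

theorem mem_H1_iff {w : R.Tuple} : w ∈ R.H1 ↔ ∀ (φ : ℝ × ℝ → ℝ) (hφ : ContDiff ℝ 1 φ),
    (⟪val w, ofCont R.isBounded_domain ⟨_, continuous_fderiv_apply_const hφ (1, 0)⟩⟫_ℝ +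
        ⟪dx w, ofCont R.isBounded_domain ⟨φ, hφ.continuous⟩⟫_ℝ =
      ⟪right w, ofCont (Metric.isBounded_Ioo R.c R.d)
          ⟨fun y => φ (R.b, y), hφ.continuous.comp (by fun_prop)⟩⟫_ℝ -
        ⟪left w, ofCont (Metric.isBounded_Ioo R.c R.d)
          ⟨fun y => φ (R.a, y), hφ.continuous.comp (by fun_prop)⟩⟫_ℝ) ∧
    (⟪val w, ofCont R.isBounded_domain ⟨_, continuous_fderiv_apply_const hφ (0, 1)⟩⟫_ℝ +
        ⟪dy w, ofCont R.isBounded_domain ⟨φ, hφ.continuous⟩⟫_ℝ =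
      ⟪top w, ofCont (Metric.isBounded_Ioo R.a R.b)
          ⟨fun x => φ (x, R.d), hφ.continuous.comp (by fun_prop)⟩⟫_ℝ -
        ⟪bottom w, ofCont (Metric.isBounded_Ioo R.a R.b)
          ⟨fun x => φ (x, R.c), hφ.continuous.comp (by fun_prop)⟩⟫_ℝ) := by
  simp only [inner_ofCont, ContinuousMap.coe_mk]
  rfl

theorem add_smul_mem_H1 {u v : R.Tuple} (hu : u ∈ R.H1) (hv : v ∈ R.H1) (r s : ℝ) :
    r • u + s • v ∈ R.H1 := by
  rw [mem_H1_iff] at *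
  intro φ hφ
  obtain ⟨h1, h2⟩ := hu φ hφ
  obtain ⟨h3, h4⟩ := hv φ hφ
  simp only [val, dx, dy, left, right, bottom, top, Prod.snd_add, Prod.fst_add,
    Prod.smul_fst, Prod.smul_snd, inner_add_left, real_inner_smul_left] at *
  constructor
  · linear_combination r * h1 + s * h3
  · linear_combination r * h2 + s * h4

theorem integral_domain_add (R : Rectangle) {F G : ℝ × ℝ → ℝ} (hF : Continuous F)
    (hG : Continuous G) :
    (∫ z in R.domain, F z) + ∫ z in R.domain, G z = ∫ z in R.domain, (F z + G z) :=
  (integral_add (integrableOn_rect hF) (integrableOn_rect hG)).symm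

/-- The tuple of a product `p ⊗ q`. -/
def prodTuple (R : Rectangle) (p p' q q' : C(ℝ, ℝ)) : R.Tuple :=
  (ofCont R.isBounded_domain (tensorFst p q),
    (ofCont R.isBounded_domain (tensorFst p' q), ofCont R.isBounded_domain (tensorFst p q')),
    (ofCont (Metric.isBounded_Ioo R.c R.d) (p R.a • q),
      ofCont (Metric.isBounded_Ioo R.c R.d) (p R.b • q)),
    (ofCont (Metric.isBounded_Ioo R.a R.b) (q R.c • p),
      ofCont (Metric.isBounded_Ioo R.a R.b) (q R.d • p)))

theorem prodTuple_mem_H1 {p p' q q' : C(ℝ, ℝ)} (hp : ∀ x, HasDerivAt p (p' x) x)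
    (hq : ∀ x, HasDerivAt q (q' x) x) : R.prodTuple p p' q q' ∈ R.H1 := by
  intro φ hφ
  have cφ := hφ.continuous
  have c1 := continuous_fderiv_apply_const hφ (1, 0)
  have c2 := continuous_fderiv_apply_const hφ (0, 1)
  constructor
  · change (∫ z in R.domain, ofCont _ _ z * _) + (∫ z in R.domain, ofCont _ _ z * _) =
      (∫ y in Ioo R.c R.d, ofCont _ _ y * _) - (∫ y in Ioo R.c R.d, ofCont _ _ y * _)
    simp only [setIntegral_ofCont_mul]
    rw [R.integral_domain_add (by fun_prop) (by fun_prop),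
      R.integral_domain' (by fun_prop), setIntegral_Ioo_eq R.hcd.le, setIntegral_Ioo_eq R.hcd.le,
      ← intervalIntegral.integral_sub (Continuous.intervalIntegrable (by fun_prop) _ _)
        (Continuous.intervalIntegrable (by fun_prop) _ _)]
    refine intervalIntegral.integral_congr fun y _ => ?_
    have hd : ∀ x ∈ uIcc R.a R.b, HasDerivAt (fun x => p x * q y * φ (x, y))
        (tensorFst p q (x, y) * fderiv ℝ φ (x, y) (1, 0) + tensorFst p' q (x, y) * φ (x, y)) x :=
      fun x _ => (((hp x).mul_const (q y)).mul (fderiv_apply_one_zero hφ x y)).congr_deriv (by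
        simp; ring)
    exact intervalIntegral.integral_eq_sub_of_hasDerivAt hd
      (Continuous.intervalIntegrable (by fun_prop) _ _)
  · change (∫ z in R.domain, ofCont _ _ z * _) + (∫ z in R.domain, ofCont _ _ z * _) =
      (∫ y in Ioo R.a R.b, ofCont _ _ y * _) - (∫ y in Ioo R.a R.b, ofCont _ _ y * _)
    simp only [setIntegral_ofCont_mul]
    rw [R.integral_domain_add (by fun_prop) (by fun_prop),
      R.integral_domain (by fun_prop), setIntegral_Ioo_eq R.hab.le, setIntegral_Ioo_eq R.hab.le,
      ← intervalIntegral.integral_sub (Continuous.intervalIntegrable (by fun_prop) _ _)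
        (Continuous.intervalIntegrable (by fun_prop) _ _)]
    refine intervalIntegral.integral_congr fun x _ => ?_
    have hd : ∀ y ∈ uIcc R.c R.d, HasDerivAt (fun y => q y * p x * φ (x, y))
        (tensorFst p q (x, y) * fderiv ℝ φ (x, y) (0, 1) + tensorFst p q' (x, y) * φ (x, y)) y :=
      fun y _ => (((hq y).mul_const (p x)).mul (fderiv_apply_zero_one hφ x y)).congr_deriv (by
        simp; ring)
    exact intervalIntegral.integral_eq_sub_of_hasDerivAt hd
      (Continuous.intervalIntegrable (by fun_prop) _ _)

/-- Gauss-Green with test functions `p' ⊗ q` and `p ⊗ q'`: their derivatives return `-μ` and `-ν`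
times `p ⊗ q`, and the Robin conditions turn the boundary terms into the trace part of the form. -/
theorem robinInner_prodTuple {β μ ν : ℝ} {p p' q q' : C(ℝ, ℝ)}
    (hp : RobinMode β R.a R.b μ p p') (hq : RobinMode β R.c R.d ν q q') {w : R.Tuple}
    (hw : w ∈ R.H1) :
    robinInner β w (R.prodTuple p p' q q') =
      (μ + ν) * ⟪val w, val (R.prodTuple p p' q q')⟫_ℝ := by
  have hc1 : ContDiff ℝ 1 fun z : ℝ × ℝ => p' z.1 * q z.2 :=
    (hp.contDiff'.comp contDiff_fst).mul (hq.contDiff.comp contDiff_snd)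
  have hc2 : ContDiff ℝ 1 fun z : ℝ × ℝ => p z.1 * q' z.2 :=
    (hp.contDiff.comp contDiff_fst).mul (hq.contDiff'.comp contDiff_snd)
  have h1 := (hw _ hc1).1
  have h2 := (hw _ hc2).2
  have f1 : ∀ z : ℝ × ℝ, fderiv ℝ (fun z : ℝ × ℝ => p' z.1 * q z.2) z (1, 0) =
      -(μ * (p z.1 * q z.2)) := fun z =>
    (fderiv_apply_one_zero hc1 z.1 z.2).unique
      (((hp.hasDeriv' z.1).mul_const (q z.2)).congr_deriv (by ring))
  have f2 : ∀ z : ℝ × ℝ, fderiv ℝ (fun z : ℝ × ℝ => p z.1 * q' z.2) z (0, 1) =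
      -(ν * (p z.1 * q z.2)) := fun z =>
    (fderiv_apply_zero_one hc2 z.1 z.2).unique
      (((hq.hasDeriv' z.2).const_mul (p z.1)).congr_deriv (by ring))
  simp only [f1, f2, hp.left, hp.right, hq.left, hq.right, mul_neg, neg_mul, integral_neg, mul_assoc,
    mul_left_comm _ β, mul_left_comm _ μ, mul_left_comm _ ν, integral_const_mul] at h1 h2
  change ⟪dx w, ofCont _ _⟫_ℝ + ⟪dy w, ofCont _ _⟫_ℝ + β * (⟪left w, ofCont _ _⟫_ℝ +
    ⟪right w, ofCont _ _⟫_ℝ + ⟪bottom w, ofCont _ _⟫_ℝ + ⟪top w, ofCont _ _⟫_ℝ) =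
    (μ + ν) * ⟪val w, ofCont _ _⟫_ℝ
  simp only [inner_ofCont, tensorFst_apply, ContinuousMap.smul_apply, smul_eq_mul]
  simp only [mul_comm (q R.c), mul_comm (q R.d)]
  linarith

theorem norm_sq_val_prodTuple_pos {p p' q q' : C(ℝ, ℝ)} (hp : 0 < ∫ x in R.a..R.b, p x ^ 2)
    (hq : 0 < ∫ y in R.c..R.d, q y ^ 2) : 0 < ‖val (R.prodTuple p p' q q')‖ ^ 2 := by
  change 0 < ‖ofCont _ _‖ ^ 2
  rw [norm_sq_ofCont, R.integral_domain (by fun_prop)]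
  simp only [tensorFst_apply, mul_pow, intervalIntegral.integral_const_mul,
    intervalIntegral.integral_mul_const]
  exact mul_pos hp hq

end Rectangle

/-! ### The first two eigenvalues of a rectangle by min-max -/

namespace Rectangle

variable {R : Rectangle}

/-- The min-max excludes only the zero tuple; this ensures that no Rayleigh quotient in it has
denominator zero. -/
theorem norm_sq_val_pos {w : R.Tuple} (hw : w ∈ R.H1) (h0 : w ≠ 0) : 0 < ‖val w‖ ^ 2 :=
  pow_pos (norm_pos_iff.2 fun h => h0 (eq_zero_of_val_eq_zero hw h)) 2

theorem robinEigenvalue_one_eq {β l : ℝ} {u : R.Tuple} (hu : u ∈ R.H1)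
    (hval : 0 < ‖val u‖ ^ 2)
    (hue : ∀ w ∈ R.H1, robinInner β w u = l * ⟪val w, val u⟫_ℝ)
    (hlow : ∀ w ∈ R.H1, l * ‖val w‖ ^ 2 ≤ R.robinForm β w) :
    R.robinEigenvalue 1 β = l := by
  have hu0 : u ≠ 0 := by rintro rfl; simp [val] at hval
  refine IsLeast.csInf_eq ⟨⟨Submodule.span ℝ {u}, ?_, finrank_span_singleton hu0, ?_, ?_⟩, ?_⟩
  · intro w hw
    obtain ⟨r, rfl⟩ := Submodule.mem_span_singleton.1 hw
    simpa using add_smul_mem_H1 hu hu r 0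
  · refine ⟨u, Submodule.mem_span_singleton_self u, hu0, ?_⟩
    rw [rayleigh_eq, robinForm_eq_inner, hue u hu, real_inner_self_eq_norm_sq,
      mul_div_cancel_right₀ _ hval.ne']
  · rintro _ ⟨w, hw, hw0, rfl⟩
    obtain ⟨r, rfl⟩ := Submodule.mem_span_singleton.1 hw
    have hH : r • u ∈ R.H1 := by simpa using add_smul_mem_H1 hu hu r 0
    have hpos := norm_sq_val_pos hH hw0
    rw [rayleigh_eq, div_le_iff₀ hpos, robinForm_eq_inner]
    have h1 := robinInner_add_smul β (r • u) u u r 0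
    rw [zero_smul, add_zero, hue _ hH, zero_mul, add_zero] at h1
    rw [h1, ← real_inner_self_eq_norm_sq]
    have : ⟪val (r • u), val (r • u)⟫_ℝ = r * ⟪val (r • u), val u⟫_ℝ :=
      real_inner_smul_right _ _ _
    rw [this]
    exact le_of_eq (by ring)
  · rintro M ⟨U, hU, hfin, _, hM⟩
    have : Nontrivial U := Module.nontrivial_of_finrank_pos (R := ℝ) (by omega)
    obtain ⟨⟨w, hw⟩, hw0⟩ := exists_ne (0 : U)
    have hw0' : w ≠ 0 := fun h => hw0 (Subtype.ext h)
    refine le_trans ?_ (hM ⟨w, hw, hw0', rfl⟩)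
    rw [rayleigh_eq, le_div_iff₀ (norm_sq_val_pos (hU hw) hw0')]
    exact hlow w (hU hw)

/-- Courant-Fischer: the span of `u` and `v` attains `m`, and every two-dimensional subspace
contains a nonzero element orthogonal to `u`. -/
theorem robinEigenvalue_two_eq {β l m : ℝ} (hlm : l < m) {u v : R.Tuple} (hu : u ∈ R.H1)
    (hv : v ∈ R.H1) (hu1 : 0 < ‖val u‖ ^ 2) (hv1 : 0 < ‖val v‖ ^ 2)
    (hue : ∀ w ∈ R.H1, robinInner β w u = l * ⟪val w, val u⟫_ℝ)
    (hve : ∀ w ∈ R.H1, robinInner β w v = m * ⟪val w, val v⟫_ℝ)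
    (hlow : ∀ w ∈ R.H1, ⟪val w, val u⟫_ℝ = 0 → m * ‖val w‖ ^ 2 ≤ R.robinForm β w) :
    R.robinEigenvalue 2 β = m := by
  -- Eigenfunctions of a symmetric form with different eigenvalues.
  have horth : ⟪val u, val v⟫_ℝ = 0 := by
    have h1 := hue v hv
    rw [robinInner_comm, hve u hu, real_inner_comm] at h1
    have h2 : (m - l) * ⟪val v, val u⟫_ℝ = 0 := by linarith
    rcases mul_eq_zero.1 h2 with h | h
    · linarith
    · rwa [real_inner_comm]
  have hval : ∀ r s : ℝ, val (r • u + s • v) = r • val u + s • val v := fun r s => rfl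
  have hnorm : ∀ r s : ℝ, ‖val (r • u + s • v)‖ ^ 2 =
      r ^ 2 * ‖val u‖ ^ 2 + s ^ 2 * ‖val v‖ ^ 2 := fun r s => by
    rw [hval, norm_add_sq_real, real_inner_smul_left, real_inner_smul_right, horth, norm_smul,
      norm_smul, mul_pow, mul_pow, Real.norm_eq_abs, Real.norm_eq_abs, sq_abs, sq_abs]
    ring
  have hform : ∀ r s : ℝ, R.robinForm β (r • u + s • v) =
      l * (r ^ 2 * ‖val u‖ ^ 2) + m * (s ^ 2 * ‖val v‖ ^ 2) := fun r s => by
    have hH := add_smul_mem_H1 hu hv r s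
    rw [robinForm_eq_inner, robinInner_add_smul, hue _ hH, hve _ hH, hval, inner_add_left,
      inner_add_left, real_inner_smul_left, real_inner_smul_left, real_inner_smul_left,
      real_inner_smul_left, real_inner_comm (val u) (val v), horth, real_inner_self_eq_norm_sq,
      real_inner_self_eq_norm_sq]
    ring
  have hv0 : v ≠ 0 := by rintro rfl; simp [val] at hv1
  have hli : LinearIndependent ℝ ![u, v] := by
    rw [LinearIndependent.pair_iff]
    intro r s h
    have h1 := hnorm r s
    rw [h] at h1
    have h0 : val (0 : R.Tuple) = 0 := rfl
    rw [h0, norm_zero] at h1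
    have a1 := mul_nonneg (sq_nonneg r) hu1.le
    have a2 := mul_nonneg (sq_nonneg s) hv1.le
    have b1 : r ^ 2 * ‖val u‖ ^ 2 = 0 := by linarith
    have b2 : s ^ 2 * ‖val v‖ ^ 2 = 0 := by linarith
    exact ⟨by simpa using (mul_eq_zero.1 b1).resolve_right hu1.ne',
      by simpa using (mul_eq_zero.1 b2).resolve_right hv1.ne'⟩
  refine IsLeast.csInf_eq ⟨⟨Submodule.span ℝ {u, v}, ?_, ?_, ?_, ?_⟩, ?_⟩
  · intro w hw
    obtain ⟨r, s, rfl⟩ := Submodule.mem_span_pair.1 hw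
    exact add_smul_mem_H1 hu hv r s
  · rw [← Matrix.range_cons_cons_empty u v ![], finrank_span_eq_card hli, Fintype.card_fin]
  · refine ⟨v, Submodule.subset_span (by simp), hv0, ?_⟩
    rw [rayleigh_eq, robinForm_eq_inner, hve v hv, real_inner_self_eq_norm_sq,
      mul_div_cancel_right₀ _ hv1.ne']
  · rintro _ ⟨w, hw, hw0, rfl⟩
    obtain ⟨r, s, rfl⟩ := Submodule.mem_span_pair.1 hw
    have hpos := norm_sq_val_pos (add_smul_mem_H1 hu hv r s) hw0
    rw [rayleigh_eq, div_le_iff₀ hpos, hform, hnorm]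
    have := mul_le_mul_of_nonneg_right hlm.le (mul_nonneg (sq_nonneg r) hu1.le)
    linarith
  · rintro M ⟨U, hU, hfin, _, hM⟩
    let f : U →ₗ[ℝ] ℝ :=
      { toFun := fun w => ⟪val (w : R.Tuple), val u⟫_ℝ
        map_add' := fun w w' => inner_add_left _ _ _
        map_smul' := fun r w => real_inner_smul_left _ _ _ }
    -- `finrank` is `0` in infinite dimension, so the value `2` forces finite dimension.
    have : FiniteDimensional ℝ U := Module.finite_of_finrank_pos (by omega)
    have hker : LinearMap.ker f ≠ ⊥ := fun h => by
      have := LinearMap.finrank_le_finrank_of_injective (LinearMap.ker_eq_bot.1 h)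
      rw [hfin, Module.finrank_self] at this
      omega
    obtain ⟨⟨w, hw⟩, hwk, hw0⟩ := (Submodule.ne_bot_iff _).1 hker
    have hw0' : w ≠ 0 := fun h => hw0 (Subtype.ext h)
    refine le_trans ?_ (hM ⟨w, hw, hw0', rfl⟩)
    rw [rayleigh_eq, le_div_iff₀ (norm_sq_val_pos (hU hw) hw0')]
    exact hlow w (hU hw) (LinearMap.mem_ker.1 hwk)

variable {β k κ l μ : ℝ}

theorem form_lower_bound (hβ : 0 < β) (hx : RobinFreq β ((R.b - R.a) / 2) k κ)
    (hy : RobinFreq β ((R.d - R.c) / 2) l μ) {w : R.Tuple} (hw : w ∈ R.H1) :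
    (k ^ 2 + l ^ 2) * ‖val w‖ ^ 2 ≤ R.robinForm β w := by
  have h1 := fst_form_bound hβ hx hw
  have h2 := snd_form_bound hβ hy hw
  have h3 := pow_le_pow_left₀ (norm_nonneg _)
    ((R.fstSpace (R.cosFst k)).norm_starProjection_apply_le (val w)) 2
  have h4 := pow_le_pow_left₀ (norm_nonneg _)
    ((R.sndSpace (R.cosSnd l)).norm_starProjection_apply_le (val w)) 2
  have h5 := mul_le_mul_of_nonneg_left h3 (sub_pos.2 hx.sq_lt).le
  have h6 := mul_le_mul_of_nonneg_left h4 (sub_pos.2 hy.sq_lt).le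
  rw [robinForm_eq_norm]
  linarith

/-- Beyond `(k² + l²)‖w‖²`, the two directional bounds leave each gap times `‖w‖²` minus a squared
projection. Both gaps are at least `g`, and the two squared projections sum to at most `‖w‖²`, so a
full `g‖w‖²` remains. -/
theorem form_lower_bound_of_orthogonal (hβ : 0 < β) (hx : RobinFreq β ((R.b - R.a) / 2) k κ)
    (hy : RobinFreq β ((R.d - R.c) / 2) l μ) {w : R.Tuple} (hw : w ∈ R.H1)
    (ho : ⟪val w, ofCont R.isBounded_domain (tensorFst (R.cosFst k) (R.cosSnd l))⟫_ℝ = 0) :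
    (k ^ 2 + l ^ 2 + min (κ ^ 2 - k ^ 2) (μ ^ 2 - l ^ 2)) * ‖val w‖ ^ 2 ≤ R.robinForm β w := by
  have h1 := fst_form_bound hβ hx hw
  have h2 := snd_form_bound hβ hy hw
  have h3 := pow_le_pow_left₀ (norm_nonneg _)
    ((R.fstSpace (R.cosFst k)).norm_starProjection_apply_le (val w)) 2
  have h4 := pow_le_pow_left₀ (norm_nonneg _)
    ((R.sndSpace (R.cosSnd l)).norm_starProjection_apply_le (val w)) 2
  have h5 := R.norm_sq_proj_add_le (integral_cosMode_sq_pos hx).ne' (integral_cosMode_sq_pos hy).ne'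
    rfl rfl ho
  change ‖(R.fstSpace (R.cosFst k)).starProjection (val w)‖ ^ 2 +
    ‖(R.sndSpace (R.cosSnd l)).starProjection (val w)‖ ^ 2 ≤ ‖val w‖ ^ 2 at h5
  rw [robinForm_eq_norm]
  set g := min (κ ^ 2 - k ^ 2) (μ ^ 2 - l ^ 2) with hg
  have hg1 : g ≤ κ ^ 2 - k ^ 2 := min_le_left _ _
  have hg2 : g ≤ μ ^ 2 - l ^ 2 := min_le_right _ _
  have hg0 : 0 < g := lt_min (sub_pos.2 hx.sq_lt) (sub_pos.2 hy.sq_lt)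
  have h6 := mul_le_mul_of_nonneg_right hg1 (sub_nonneg.2 h3)
  have h7 := mul_le_mul_of_nonneg_right hg2 (sub_nonneg.2 h4)
  have h8 := mul_le_mul_of_nonneg_left h5 hg0.le
  linarith

theorem robinEigenvalue_one (hβ : 0 < β) (hx : RobinFreq β ((R.b - R.a) / 2) k κ)
    (hy : RobinFreq β ((R.d - R.c) / 2) l μ) : R.robinEigenvalue 1 β = k ^ 2 + l ^ 2 :=
  robinEigenvalue_one_eq
    (prodTuple_mem_H1 (robinMode_even hx).hasDeriv (robinMode_even hy).hasDeriv)
    (norm_sq_val_prodTuple_pos (integral_cosMode_sq_pos hx) (integral_cosMode_sq_pos hy))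
    (fun _ hw => robinInner_prodTuple (robinMode_even hx) (robinMode_even hy) hw)
    (fun _ hw => form_lower_bound hβ hx hy hw)

theorem robinEigenvalue_two (hβ : 0 < β) (hx : RobinFreq β ((R.b - R.a) / 2) k κ)
    (hy : RobinFreq β ((R.d - R.c) / 2) l μ) :
    R.robinEigenvalue 2 β = k ^ 2 + l ^ 2 + min (κ ^ 2 - k ^ 2) (μ ^ 2 - l ^ 2) := by
  have hg0 : 0 < min (κ ^ 2 - k ^ 2) (μ ^ 2 - l ^ 2) :=
    lt_min (sub_pos.2 hx.sq_lt) (sub_pos.2 hy.sq_lt)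
  obtain ⟨v, hv, hv1, hve⟩ : ∃ v ∈ R.H1, 0 < ‖val v‖ ^ 2 ∧ ∀ w ∈ R.H1, robinInner β w v =
      (k ^ 2 + l ^ 2 + min (κ ^ 2 - k ^ 2) (μ ^ 2 - l ^ 2)) * ⟪val w, val v⟫_ℝ := by
    -- The odd mode goes in the direction with the smaller gap, the even mode in the other.
    rcases min_choice (κ ^ 2 - k ^ 2) (μ ^ 2 - l ^ 2) with h | h
    · refine ⟨_, prodTuple_mem_H1 (robinMode_odd hx).hasDeriv (robinMode_even hy).hasDeriv,
        norm_sq_val_prodTuple_pos (integral_oddMode_sq_pos hx) (integral_cosMode_sq_pos hy),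
        fun w hw => ?_⟩
      rw [h, robinInner_prodTuple (robinMode_odd hx) (robinMode_even hy) hw]
      ring
    · refine ⟨_, prodTuple_mem_H1 (robinMode_even hx).hasDeriv (robinMode_odd hy).hasDeriv,
        norm_sq_val_prodTuple_pos (integral_cosMode_sq_pos hx) (integral_oddMode_sq_pos hy),
        fun w hw => ?_⟩
      rw [h, robinInner_prodTuple (robinMode_even hx) (robinMode_odd hy) hw]
      ring
  exact robinEigenvalue_two_eq (by linarith)
    (prodTuple_mem_H1 (robinMode_even hx).hasDeriv (robinMode_even hy).hasDeriv) hv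
    (norm_sq_val_prodTuple_pos (integral_cosMode_sq_pos hx) (integral_cosMode_sq_pos hy)) hv1
    (fun _ hw => robinInner_prodTuple (robinMode_even hx) (robinMode_even hy) hw) hve
    (fun _ hw ho => form_lower_bound_of_orthogonal hβ hx hy hw ho)

/-! ### Optimising the spectral ratio over rectangles -/

theorem sq_div_eq_scaled {β t r : ℝ} (hβ : 0 < β) (ht : 0 < t) :
    (r / t) ^ 2 = β ^ 2 * (r / (β * t)) ^ 2 := by
  field_simp

theorem robinEigenvalue_one_eq_scaled (R : Rectangle) {β : ℝ} (hβ : 0 < β) :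
    R.robinEigenvalue 1 β = β ^ 2 * (scaledFirst (β * ((R.b - R.a) / 2)) +
      scaledFirst (β * ((R.d - R.c) / 2))) := by
  have hx : 0 < (R.b - R.a) / 2 := by linarith [R.hab]
  have hy : 0 < (R.d - R.c) / 2 := by linarith [R.hcd]
  rw [robinEigenvalue_one hβ (robinFreq_of_pos hβ hx) (robinFreq_of_pos hβ hy),
    sq_div_eq_scaled hβ hx, sq_div_eq_scaled hβ hy, scaledFirst, scaledFirst]
  ring

theorem robinEigenvalue_two_eq_scaled (R : Rectangle) {β : ℝ} (hβ : 0 < β) :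
    R.robinEigenvalue 2 β = β ^ 2 * (scaledFirst (β * ((R.b - R.a) / 2)) +
      scaledFirst (β * ((R.d - R.c) / 2)) +
      min (scaledGap (β * ((R.b - R.a) / 2))) (scaledGap (β * ((R.d - R.c) / 2)))) := by
  have hx : 0 < (R.b - R.a) / 2 := by linarith [R.hab]
  have hy : 0 < (R.d - R.c) / 2 := by linarith [R.hcd]
  rw [robinEigenvalue_two hβ (robinFreq_of_pos hβ hx) (robinFreq_of_pos hβ hy),
    sq_div_eq_scaled hβ hx, sq_div_eq_scaled hβ hy, sq_div_eq_scaled hβ hx,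
    sq_div_eq_scaled hβ hy, scaledFirst, scaledFirst, scaledGap, scaledGap, mul_add,
    mul_min_of_nonneg _ _ (sq_nonneg β)]
  simp only [mul_sub, mul_add]

theorem perimeter_pos (R : Rectangle) : 0 < R.perimeter := by
  have := R.hab; have := R.hcd; unfold perimeter; linarith

theorem scaledFirst_add_pos (R : Rectangle) {β : ℝ} (hβ : 0 < β) :
    0 < scaledFirst (β * ((R.b - R.a) / 2)) + scaledFirst (β * ((R.d - R.c) / 2)) :=
  add_pos (scaledFirst_pos (mul_pos hβ (by linarith [R.hab])))
    (scaledFirst_pos (mul_pos hβ (by linarith [R.hcd])))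

theorem spectralRatio_eq (R : Rectangle) {α : ℝ} (hα : 0 < α) :
    R.spectralRatio α = 1 + min (scaledGap (α / R.perimeter * ((R.b - R.a) / 2)))
        (scaledGap (α / R.perimeter * ((R.d - R.c) / 2))) /
      (scaledFirst (α / R.perimeter * ((R.b - R.a) / 2)) +
        scaledFirst (α / R.perimeter * ((R.d - R.c) / 2))) := by
  have hβ : 0 < α / R.perimeter := div_pos hα R.perimeter_pos
  have hpos := R.scaledFirst_add_pos hβ
  rw [spectralRatio, R.robinEigenvalue_one_eq_scaled hβ, R.robinEigenvalue_two_eq_scaled hβ,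
    abs_of_pos (mul_pos (pow_pos hβ 2) hpos), mul_div_mul_left _ _ (pow_pos hβ 2).ne', add_div,
    div_self hpos.ne']

theorem spectralRatio_of_isSq {R : Rectangle} (h : R.IsSq) {α : ℝ} (hα : 0 < α) :
    R.spectralRatio α = 1 + scaledGap (α / 8) / (2 * scaledFirst (α / 8)) := by
  have hL := R.perimeter_pos
  have h1 : α / R.perimeter * ((R.b - R.a) / 2) = α / 8 := by
    have : (R.b - R.a) / 2 = R.perimeter / 8 := by
      unfold IsSq at h; unfold perimeter; linarith
    rw [this]; field_simp
  have h2 : α / R.perimeter * ((R.d - R.c) / 2) = α / 8 := by rw [← h1, h]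
  rw [R.spectralRatio_eq hα, h1, h2, min_self, two_mul]

theorem scaledGap_pos {s : ℝ} (hs : 0 < s) : 0 < scaledGap s := by
  have := (evenRoot_mem hs).1
  rw [scaledGap, sub_pos]
  gcongr
  exact (evenRoot_mem hs).2.trans (oddRoot_mem hs).1

/-- The scaled half-sides are distinct with mean `α / 8`. Midpoint convexity bounds the denominator
below, and the larger half-side exceeds `α / 8`, so its gap is strictly below `scaledGap (α / 8)`.
-/
theorem spectralRatio_lt_of_not_isSq {R : Rectangle} (h : ¬ R.IsSq) {α : ℝ} (hα : 0 < α) :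
    R.spectralRatio α < 1 + scaledGap (α / 8) / (2 * scaledFirst (α / 8)) := by
  have hL := R.perimeter_pos
  have hβ : 0 < α / R.perimeter := div_pos hα hL
  rw [R.spectralRatio_eq hα]
  have hs : 0 < α / R.perimeter * ((R.b - R.a) / 2) := mul_pos hβ (by linarith [R.hab])
  have ht : 0 < α / R.perimeter * ((R.d - R.c) / 2) := mul_pos hβ (by linarith [R.hcd])
  have hsum : α / R.perimeter * ((R.b - R.a) / 2) + α / R.perimeter * ((R.d - R.c) / 2) =
      2 * (α / 8) := by
    have : (R.b - R.a) / 2 + (R.d - R.c) / 2 = R.perimeter / 4 := by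
      unfold perimeter; ring
    rw [← mul_add, this]; field_simp; norm_num
  have hne : α / R.perimeter * ((R.b - R.a) / 2) ≠ α / R.perimeter * ((R.d - R.c) / 2) := by
    intro e
    have := mul_left_cancel₀ hβ.ne' e
    exact h (by unfold IsSq; linarith)
  generalize α / R.perimeter * ((R.b - R.a) / 2) = s at *
  generalize α / R.perimeter * ((R.d - R.c) / 2) = t at *
  have hσ : 0 < α / 8 := by positivity
  have hconv : 2 * scaledFirst (α / 8) ≤ scaledFirst s + scaledFirst t := by
    have := convexOn_scaledFirst.2 (mem_Ioi.2 hs) (mem_Ioi.2 ht) (by norm_num : (0 : ℝ) ≤ 1 / 2)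
      (by norm_num : (0 : ℝ) ≤ 1 / 2) (by norm_num)
    simp only [smul_eq_mul] at this
    rw [show 1 / 2 * s + 1 / 2 * t = α / 8 by linarith] at this
    linarith
  have hgap : min (scaledGap s) (scaledGap t) < scaledGap (α / 8) := by
    rcases lt_or_gt_of_ne hne with hlt | hlt
    · exact (min_le_right _ _).trans_lt (strictAntiOn_scaledGap hσ ht (by linarith))
    · exact (min_le_left _ _).trans_lt (strictAntiOn_scaledGap hσ hs (by linarith))
  have hA := scaledFirst_pos hσ
  have hG := scaledGap_pos hσ
  gcongr

end Rectangle

end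

theorem mainTheorem10 (α : ℝ) (hα : 0 < α) :
    (∀ R : Rectangle, 0 < R.robinEigenvalue 1 (α / R.perimeter)) ∧
    ∀ S : Rectangle, (∀ R : Rectangle, R.spectralRatio α ≤ S.spectralRatio α) ↔ S.IsSq := by
  refine ⟨fun R => ?_, fun S => ⟨fun h => ?_, fun h R => ?_⟩⟩
  · have hβ : 0 < α / R.perimeter := div_pos hα R.perimeter_pos
    rw [R.robinEigenvalue_one_eq_scaled hβ]
    exact mul_pos (pow_pos hβ 2) (R.scaledFirst_add_pos hβ)
  · by_contra hS
    -- Any square serves as competitor, since all squares share the same ratio.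
    have h1 := h ⟨0, 1, 0, 1, one_pos, one_pos⟩
    rw [Rectangle.spectralRatio_of_isSq (by simp [Rectangle.IsSq]) hα] at h1
    exact absurd (Rectangle.spectralRatio_lt_of_not_isSq hS hα) (not_lt.2 h1)
  · rw [Rectangle.spectralRatio_of_isSq h hα]
    by_cases hR : R.IsSq
    · exact (Rectangle.spectralRatio_of_isSq hR hα).le
    · exact (Rectangle.spectralRatio_lt_of_not_isSq hR hα).le
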